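/- Fix countably infinite, pairwise disjoint sets of individual names, concept names and role names, and a partition of the role names into call, internal and return letters. Words are taken over the alphabet whose letters are the role names and the tests $A?$ for concept names $A$; tests count as internal letters. Concepts of $\mathcal{ALCO}_{\mathsf{vpl}}$ are given by the grammar \[ C, D ::= \top \mid A \mid \neg C \mid C \sqcap D \mid \{a\} \mid \exists r.C \mid \exists \mathcal{L}.C , \] where $A$ is a concept name, $a$ an individual name, $r$ a role name, and $\mathcal{L}$ a visibly-pushdown language over a finite subset of this pushdown alphabet, represented by a nondeterministic visibly-pushdown automaton. An interpretation $\mathcal{I}$ has a non-empty domain $\Delta^{\mathcal I}$ and assigns elements of $\Delta^{\mathcal I}$ to individual names, subsets of it to concept names and binary relations on it to role names. Boolean constructors and $\exists r.C$ are interpreted as usual, $\{a\}^{\mathcal I} = \{a^{\mathcal I}\}$, and $d \in (\exists \mathcal{L}.C)^{\mathcal I}$ iff there are a word $w_1 \cdots w_n \in \mathcal{L}$ and elements $d = d_1, \ldots, d_{n+1} \in \Delta^{\mathcal I}$ with $d_{n+1} \in C^{\mathcal I}$ such that for each $i \le n$ either $w_i$ is a role name and $(d_i, d_{i+1}) \in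 w_i^{\mathcal I}$, or $w_i = A?$, $d_i = d_{i+1}$ and $d_i \in A^{\mathcal I}$. A concept $C$ is satisfiable if $C^{\mathcal I} \neq \emptyset$ for some interpretation $\mathcal{I}$. **Theorem.** Let $r$ be a call letter and $s$ a return letter. The problem of deciding whether an input $\mathcal{ALCO}_{\mathsf{vpl}}$-concept is satisfiable is undecidable. It remains undecidable when restricted to input concepts in which all languages in existential restrictions (with $\exists r.C$ read as the restriction by the one-word language $\{r\}$) belong to \[ \{\, r,\ s,\ r^+,\ s^+,\ r^*,\ s^*,\ (r+s)^*,\ (r+s)^+,\ \{ r^n s^n \mid n \in \mathbb{N} \} \,\}, \] where $\mathbb{N}$ contains $0$. -/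

import Mathlib

open scoped Computability

namespace ALCO

/-- Individual names, concept names and role names: three countably infinite sets. -/
abbrev IndName := ℕ

abbrev ConceptName := ℕ

abbrev RoleName := ℕ

/-- The three classes of letters of a pushdown alphabet. -/
inductive LetterKind
  | call
  | internal
  | ret

/-- The alphabet of path expressions: role names `r` and tests `A?` for concept names `A`. -/
abbrev Letter := RoleName ⊕ ConceptName

abbrev Letter.role (r : RoleName) : Letter := Sum.inl r

abbrev Letter.test (A : ConceptName) : Letter := Sum.inr A

/-- A finite presentation of a nondeterministic visibly-pushdown automaton. States and stack
symbols other than the bottom-of-stack symbol are named by natural numbers; the finite sets of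
states and of stack symbols consist of the finitely many names that occur in the lists.
A call transition `(q, a, q', γ)` reads `a` in state `q`, moves to `q'` and pushes `γ`.
An internal transition `(q, a, q')` leaves the stack unchanged.
A return transition `(q, a, some γ, q')` pops `γ`, and `(q, a, none, q')` is applicable exactly
when only the bottom-of-stack symbol (represented by `none`) is left, which stays on the stack. -/
structure VPA where
  initials : List ℕ
  finals : List ℕ
  calls : List (ℕ × RoleName × ℕ × ℕ)
  internals : List (ℕ × Letter × ℕ)
  returns : List (ℕ × RoleName × Option ℕ × ℕ)

namespace VPA

/-- The automaton respects the partition `κ` of the role names into call, internal and return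
letters; tests `A?` are internal letters. -/
def IsOver (κ : RoleName → LetterKind) (M : VPA) : Prop :=
  (∀ t ∈ M.calls, κ t.2.1 = LetterKind.call) ∧
  (∀ q a q', (q, Letter.role a, q') ∈ M.internals → κ a = LetterKind.internal) ∧
  (∀ t ∈ M.returns, κ t.2.1 = LetterKind.ret)

/-- One step between configurations. A configuration is a state together with the stack content,
listed from the top and without the bottom-of-stack symbol, which is always present below it. -/
inductive Step (M : VPA) : Letter → ℕ × List ℕ → ℕ × List ℕ → Prop
  | call (q q' γ : ℕ) (a : RoleName) (σ : List ℕ) (h : (q, a, q', γ) ∈ M.calls) :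
      Step M (Letter.role a) (q, σ) (q', γ :: σ)
  | internal (q q' : ℕ) (a : Letter) (σ : List ℕ) (h : (q, a, q') ∈ M.internals) :
      Step M a (q, σ) (q', σ)
  | pop (q q' γ : ℕ) (a : RoleName) (σ : List ℕ) (h : (q, a, some γ, q') ∈ M.returns) :
      Step M (Letter.role a) (q, γ :: σ) (q', σ)
  | bottom (q q' : ℕ) (a : RoleName) (h : (q, a, none, q') ∈ M.returns) :
      Step M (Letter.role a) (q, []) (q', [])

/-- There is a sequence of steps reading the given word between the given configurations. -/
def Steps (M : VPA) : List Letter → ℕ × List ℕ → ℕ × List ℕ → Prop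
  | [], c, c' => c = c'
  | a :: w, c, c' => ∃ d, M.Step a c d ∧ M.Steps w d c'

/-- The words with a run from an initial state and the empty stack (bottom symbol only)
to a configuration with a final state. -/
def language (M : VPA) : Language Letter :=
  {w | ∃ q₀ ∈ M.initials, ∃ q ∈ M.finals, ∃ σ, M.Steps w (q₀, []) (q, σ)}

/-- Code of an automaton as a natural number. -/
def code (M : VPA) : ℕ :=
  Encodable.encode (M.initials, M.finals, M.calls, M.internals, M.returns)

theorem code_injective : Function.Injective code := by
  intro M N h
  have h' := Encodable.encode_injective h
  cases M
  cases N
  simp only [Prod.mk.injEq] at h'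
  obtain ⟨h1, h2, h3, h4, h5⟩ := h'
  subst h1 h2 h3 h4 h5
  rfl

end VPA

/-- Concepts of ALC with path expressions (given by automata) and nominals. -/
inductive Concept
  | top : Concept
  | atom (A : ConceptName) : Concept
  | neg (C : Concept) : Concept
  | inter (C D : Concept) : Concept
  | nominal (a : IndName) : Concept
  | existsRole (r : RoleName) (C : Concept) : Concept
  | existsPath (M : VPA) (C : Concept) : Concept

/-- Interpretations. The domain is non-empty because individual names denote elements.
Different individual names may denote the same element. -/
structure Interpretation where
  Domain : Type
  ind : IndName → Domain
  concept : ConceptName → Set Domain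
  role : RoleName → Domain → Domain → Prop

namespace Interpretation

/-- `I.Follows w d e`: there is a path from `d` to `e` labelled by the word `w`. A role name moves
along an edge of that role; a test `A?` stays at the current element, which has to belong to `A`. -/
def Follows (I : Interpretation) : List Letter → I.Domain → I.Domain → Prop
  | [], d, e => d = e
  | Sum.inl r :: w, d, e => ∃ d', I.role r d d' ∧ I.Follows w d' e
  | Sum.inr A :: w, d, e => d ∈ I.concept A ∧ I.Follows w d e

/-- `e` is `L`-reachable from `d`. -/
def Reaches (I : Interpretation) (L : Language Letter) (d e : I.Domain) : Prop :=
  ∃ w ∈ L, I.Follows w d e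

/-- The extension of a concept. -/
def ext (I : Interpretation) : Concept → Set I.Domain
  | .top => Set.univ
  | .atom A => I.concept A
  | .neg C => (I.ext C)ᶜ
  | .inter C D => I.ext C ∩ I.ext D
  | .nominal a => {I.ind a}
  | .existsRole r C => {d | ∃ e ∈ I.ext C, I.role r d e}
  | .existsPath M C => {d | ∃ e ∈ I.ext C, I.Reaches M.language d e}

end Interpretation

namespace Concept

/-- The concept has a model. -/
def Satisfiable (C : Concept) : Prop :=
  ∃ I : Interpretation, (I.ext C).Nonempty

/-- All automata of the concept are automata over the pushdown alphabet given by `κ`: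
the concept is a concept of ALCO with visibly-pushdown path expressions. -/
def IsVPL (κ : RoleName → LetterKind) : Concept → Prop
  | top => True
  | atom _ => True
  | neg C => C.IsVPL κ
  | inter C D => C.IsVPL κ ∧ D.IsVPL κ
  | nominal _ => True
  | existsRole _ C => C.IsVPL κ
  | existsPath M C => M.IsOver κ ∧ C.IsVPL κ

/-- All languages occurring in existential restrictions of the concept belong to `𝓛`;
the role restriction for `r` counts as the language consisting of the one-letter word `r`. -/
def UsesOnly (𝓛 : Set (Language Letter)) : Concept → Prop
  | top => True
  | atom _ => True
  | neg C => C.UsesOnly 𝓛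
  | inter C D => C.UsesOnly 𝓛 ∧ D.UsesOnly 𝓛
  | nominal _ => True
  | existsRole r C => ({[Letter.role r]} : Language Letter) ∈ 𝓛 ∧ C.UsesOnly 𝓛
  | existsPath M C => M.language ∈ 𝓛 ∧ C.UsesOnly 𝓛

/-- Code of a concept as a natural number. -/
def code : Concept → ℕ
  | top => Nat.pair 0 0
  | atom A => Nat.pair 1 A
  | neg C => Nat.pair 2 C.code
  | inter C D => Nat.pair 3 (Nat.pair C.code D.code)
  | nominal a => Nat.pair 4 a
  | existsRole r C => Nat.pair 5 (Nat.pair r C.code)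
  | existsPath M C => Nat.pair 6 (Nat.pair M.code C.code)

theorem code_injective : Function.Injective code := by
  intro C
  induction C with
  | top => intro D h; cases D <;> simp [code, Nat.pair_eq_pair] at h ⊢
  | atom A => intro D h; cases D <;> simp [code, Nat.pair_eq_pair] at h ⊢; exact h
  | neg C ih => intro D h; cases D <;> simp [code, Nat.pair_eq_pair] at h ⊢; exact ih h
  | inter C C' ih ih' =>
    intro D h; cases D <;> simp [code, Nat.pair_eq_pair] at h ⊢; exact ⟨ih h.1, ih' h.2⟩
  | nominal a => intro D h; cases D <;> simp [code, Nat.pair_eq_pair] at h ⊢; exact h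
  | existsRole r C ih =>
    intro D h; cases D <;> simp [code, Nat.pair_eq_pair] at h ⊢; exact ⟨h.1, ih h.2⟩
  | existsPath M C ih =>
    intro D h; cases D <;> simp [code, Nat.pair_eq_pair] at h ⊢
    exact ⟨VPA.code_injective h.1, ih h.2⟩

/-- Concept satisfiability is decidable for input concepts from the class `P`: some partial
recursive function, given the code of a concept in `P`, halts with the correct answer.
Nothing is required on inputs that are not codes of concepts in `P`. -/
def SatDecidableOn (P : Concept → Prop) : Prop :=
  ∃ f : ℕ →. Bool, Partrec f ∧ ∀ C : Concept, P C →
    (C.Satisfiable → true ∈ f C.code) ∧ (¬ C.Satisfiable → false ∈ f C.code)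

end Concept

/-- The language of all words `rⁿ sⁿ` with `n ≥ 0`. -/
def countingLanguage (r s : RoleName) : Language Letter :=
  {w | ∃ n : ℕ, w = List.replicate n (Letter.role r) ++ List.replicate n (Letter.role s)}

/-- The language `L⁺` of concatenations of one or more words of `L`. -/
def plus (L : Language Letter) : Language Letter := L * L∗

/-- The nine languages `r`, `s`, `r⁺`, `s⁺`, `r*`, `s*`, `(r + s)*`, `(r + s)⁺` and
`{rⁿ sⁿ | n ≥ 0}`. -/
def nineLanguages (r s : RoleName) : Set (Language Letter) :=
  let R : Language Letter := {[Letter.role r]}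
  let S : Language Letter := {[Letter.role s]}
  {R, S, plus R, plus S, R∗, S∗, (R + S)∗, plus (R + S), countingLanguage r s}

end ALCO

/-! The halting problem for programs on input 0 is reduced to satisfiability. One universal machine
(`exists_universal_tm0`) is turned into one finite tile system, so only the input word varies.
Configurations are rows, written one after another as a single sequence `f` of tiles. Horizontal
neighbours are `f i`, `f (i + 1)`, and vertical neighbours are `f i`, `f (i + W)`, where the
circumference `W` is arbitrary. The machine halts iff some `W` admits a tiling that arrives at an
accepting tile (`eval_dom_of_tiles`, `exists_tilesForever`).

The concept must compare positions at the unknown distance `W`. If `o` is reached from `z` by `n`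
steps along `r`, then the words `rⁿ sⁿ` lead from `z` to the `n`-th element of any `s`-path starting
at `o`. The nominals 0 and 1 serve as origins of two such paths, each carrying a sequence of tiles.
An element with an `r`-path of length `p` to origin 0 and one of length `p + k` to origin 1 can
therefore compare entry `p` of the first sequence with entry `p + k` of the second. The copy chain
does this with `k = 0` and makes the sequences agree. The row chain does it with `k = W`, because
its end reaches origin 1 through a further `r`-chain, the width chain, and this enforces vertical
matching. The width chain itself sees the first `W` tiles and makes them initial. Nominals ensure
that all chains refer to the same two sequences; `(r + s)*` spreads the rules over the model and
makes the chains finite (`exists_chain`).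

Models yield tilings by `exists_tiles`, and tilings yield models by `satisfiable_tilingConcept`. The
concept is primitive recursive in the input, so a decision procedure for satisfiability would decide
halting. -/

namespace Turing.PartrecToTM2

/-! ### A universal one-tape machine with a primitive recursive input encoding -/

instance : Finite Γ' := Fintype.finite inferInstance

noncomputable instance : Primcodable Γ' := Primcodable.ofEquiv _ (Finite.equivFin Γ')

instance : Finite K' :=
  Set.finite_univ_iff.1 ((Set.toFinite {K'.main, K'.rev, K'.aux, K'.stack}).subset fun k _ => by
    cases k <;> simp)

/-- The alphabet of the one-tape machine that simulates the four stacks. -/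
abbrev TapeSymbol := TM2to1.Γ' K' fun _ => Γ'

noncomputable instance : Fintype TapeSymbol :=
  letI := Fintype.ofFinite K'
  TM2to1.Γ'.fintype

noncomputable instance : Primcodable TapeSymbol := Primcodable.ofEquiv _ (Finite.equivFin _)

/-- The least significant bit of the binary representation, as a tape symbol. -/
def bitSymbol (n : ℕ) : Γ' := if n % 2 = 0 then Γ'.bit0 else Γ'.bit1

theorem trNat_eq_cons {n : ℕ} (hn : n ≠ 0) : trNat n = bitSymbol n :: trNat (n / 2) := by
  obtain ⟨p, rfl⟩ : ∃ p : PosNum, (p : ℕ) = n := by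
    cases h : (n : Num) with
    | zero => exact absurd (by rw [← Num.to_of_nat n, h]; rfl) hn
    | pos p => exact ⟨p, by rw [← Num.to_of_nat n, h]; rfl⟩
  have h (q : PosNum) : trNat (q : ℕ) = trPosNum q := by
    simp [trNat, trNum]
  rw [h]
  cases p with
  | one => simp [trPosNum, bitSymbol]
  | bit0 p =>
    have : ((p.bit0 : PosNum) : ℕ) = 2 * p := by simp; omega
    rw [this]
    simp [trPosNum, bitSymbol, h]
  | bit1 p =>
    have : ((p.bit1 : PosNum) : ℕ) = 2 * p + 1 := by simp; omega
    rw [this, show (2 * (p : ℕ) + 1) / 2 = p by omega]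
    simp [trPosNum, bitSymbol, h]

/-- The digits are listed from the least significant one, so `trNat n` is obtained from `trNat (n /
2)` by strong recursion. -/
theorem primrec_trNat : Primrec trNat := by
  have hb : Primrec bitSymbol :=
    Primrec.ite (Primrec.eq.comp (Primrec.nat_mod.comp .id (.const 2)) (.const 0)) (.const _)
      (.const _)
  -- `L` lists the values at all numbers below `n`, so its length is `n` and its entry at `n / 2` is
  -- the recursive value.
  let g : Unit → List (List Γ') → Option (List Γ') := fun _ L =>
    if L.length = 0 then some []
    else some (bitSymbol L.length :: (L[L.length / 2]?).getD [])
  have hg : Primrec₂ g := by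
    have hl : Primrec fun p : Unit × List (List Γ') => p.2.length :=
      Primrec.list_length.comp .snd
    refine Primrec.ite (Primrec.eq.comp hl (.const 0)) (.const _) (Primrec.option_some.comp ?_)
    refine Primrec.list_cons.comp (hb.comp hl) (Primrec.option_getD.comp ?_ (.const []))
    exact Primrec.list_getElem?.comp .snd (Primrec.nat_div.comp hl (.const 2))
  refine (Primrec.nat_strong_rec (fun _ : Unit => trNat) hg fun _ n => ?_).comp
    (.const ()) .id
  by_cases hn : n = 0
  · simp [g, hn]
  · have : n / 2 < n := by omega
    simp [g, hn, trNat_eq_cons hn, this]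

end Turing.PartrecToTM2

open Turing PartrecToTM2 in
/-- A universal Turing machine in the one-tape model with finitely many states. -/
theorem exists_universal_tm0 : ∃ (Γ Λ : Type) (_ : Fintype Γ) (_ : Inhabited Γ) (_ : Primcodable Γ)
    (_ : Inhabited Λ) (M : TM0.Machine Γ Λ) (S : Finset Λ) (w : ℕ → List Γ),
    TM0.Supports M (S : Set Λ) ∧ Primrec w ∧
    ∀ c : Nat.Partrec.Code, (TM0.eval M (w (Encodable.encode c))).Dom ↔ (c.eval 0).Dom := by
  -- The universal function: it runs the program with number `k` on input 0. Its code is compiled to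
  -- a machine with stacks and then to one tape.
  have hU : Partrec fun k : ℕ => ((Denumerable.ofNat Nat.Partrec.Code k).eval 0 : Part ℕ) :=
    Nat.Partrec.Code.eval_part.comp (Computable.ofNat _) (Computable.const 0)
  obtain ⟨c, hc⟩ := ToPartrec.Code.exists_code (Nat.Partrec'.part_iff₁.2 hU)
  let _ : Inhabited Λ' := ⟨trNormal c Cont'.halt⟩
  have hs := TM1to0.tr_supports _ (TM2to1.tr_supports _ (tr_supports c Cont'.halt))
  refine ⟨TapeSymbol, TM1to0.Λ' (TM2to1.tr tr), inferInstance, inferInstance, inferInstance,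
    inferInstance, TM1to0.tr (TM2to1.tr tr), _,
    fun k => TM2to1.trInit K'.main (trList [k]), hs, ?_, ?_⟩
  -- `trInit` writes the stack in reverse order and marks the first cell as the bottom.
  · have h1 : Primrec fun k => (trList [k]).reverse := by
      simp only [trList]
      exact Primrec.list_reverse.comp (Primrec.list_append.comp primrec_trNat (.const _))
    let e : Γ' → TapeSymbol := fun a => (false, Function.update (fun _ => none) K'.main (some a))
    have h2 : Primrec fun k => (trList [k]).reverse.map e :=
      Primrec.list_map h1 ((Primrec.dom_finite e).comp₂ Primrec₂.right)
    let e' : TapeSymbol → TapeSymbol := fun x => (true, x.2)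
    exact (Primrec.list_cons (α := TapeSymbol)).comp
      ((Primrec.dom_finite e').comp (Primrec.list_headI.comp h2)) (Primrec.list_tail.comp h2)
  · intro d
    rw [TM1to0.tr_eval]
    refine (TM2to1.tr_eval_dom _ _ _).trans ?_
    have h1 := hc ⟨[Encodable.encode d], rfl⟩
    have h2 := tr_eval c [Encodable.encode d]
    have h3 : (TM2.init K'.main (trList [Encodable.encode d]) : TM2.Cfg (fun _ => Γ') Λ' _) =
        init c [Encodable.encode d] := by
      unfold TM2.init init
      congr 1
      funext k
      cases k <;> rfl
    unfold TM2.eval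
    rw [h3, h2, h1]
    simp only [List.Vector.head, Denumerable.ofNat_encode]
    exact Iff.rfl

/-! ### Tilings of cylinders of unknown circumference -/

/-- A finite set of tiles with horizontal and vertical matching conditions, and with a set of tiles
for each input symbol. -/
structure TileSystem (Γ : Type) where
  Tile : Type
  finite : Finite Tile
  horiz : Tile → Tile → Prop
  vert : Tile → Tile → Prop
  start : Tile → Prop
  init : Tile → Prop
  acc : Tile → Prop
  letter : Γ → Tile → Prop
  blank : Tile → Prop

namespace TileSystem

variable {Γ : Type} (𝒯 : TileSystem Γ)

/-- A sequence of tiles, wrapped around a cylinder of circumference `W`, that starts with the input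
`w` and satisfies the vertical conditions up to an accepting tile at position `m`. -/
structure Tiles (w : List Γ) (W m : ℕ) (f : ℕ → 𝒯.Tile) : Prop where
  pos : 0 < W
  horiz (i : ℕ) : 𝒯.horiz (f i) (f (i + 1))
  vert (i : ℕ) : i + W ≤ m → 𝒯.vert (f i) (f (i + W))
  init (i : ℕ) : i < W → i ≤ m → 𝒯.init (f i)
  acc : 𝒯.acc (f m)
  start : 𝒯.start (f 0)
  letter (i : ℕ) (h : i < w.length) : 𝒯.letter w[i] (f i)
  blank (i : ℕ) : w.length ≤ i → 𝒯.blank (f i)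

/-- A tiling whose conditions continue to hold beyond position `m`. -/
structure TilesForever (w : List Γ) (W m : ℕ) (f : ℕ → 𝒯.Tile) : Prop where
  pos : 0 < W
  horiz (i : ℕ) : 𝒯.horiz (f i) (f (i + 1))
  vert (i : ℕ) : 𝒯.vert (f i) (f (i + W))
  init (i : ℕ) : i < W → 𝒯.init (f i)
  acc (i : ℕ) : m ≤ i → 𝒯.acc (f i)
  start : 𝒯.start (f 0)
  letter (i : ℕ) (h : i < w.length) : 𝒯.letter w[i] (f i)
  blank (i : ℕ) : w.length ≤ i → 𝒯.blank (f i)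

end TileSystem

/-! ### Machine runs as tilings, with the tape folded at the head -/

namespace Turing.TM0

variable {Γ Λ : Type} [Inhabited Γ] [Inhabited Λ] (M : Machine Γ Λ)

/-- The successor configuration; halted configurations are repeated. -/
def next (c : Cfg Γ Λ) : Cfg Γ Λ := (step M c).getD c

/-- The configuration after `t` steps on input `w`. -/
def run (w : List Γ) (t : ℕ) : Cfg Γ Λ := (next M)^[t] (init w)

theorem run_succ (w : List Γ) (t : ℕ) : run M w (t + 1) = next M (run M w t) :=
  Function.iterate_succ_apply' _ _ _

theorem reaches_run (w : List Γ) (t : ℕ) : Reaches M (init w) (run M w t) := by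
  induction t with
  | zero => exact .refl
  | succ t ih =>
    rw [run_succ]
    unfold next
    cases h : step M (run M w t) with
    | none => exact ih
    | some c => exact ih.tail h

/-- Since `next` repeats halted configurations, `run` is total, and halting means that the run meets
a configuration without successor. -/
theorem eval_dom_iff (w : List Γ) : (eval M w).Dom ↔ ∃ t, step M (run M w t) = none := by
  constructor
  · intro h
    obtain ⟨b, h⟩ := Part.dom_iff_mem.1 (show (StateTransition.eval (step M) (init w)).Dom from h)
    obtain ⟨hr, hb⟩ := StateTransition.mem_eval.1 h
    suffices ∃ t, run M w t = b by
      obtain ⟨t, ht⟩ := this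
      exact ⟨t, ht ▸ hb⟩
    clear hb h
    induction hr with
    | refl => exact ⟨0, rfl⟩
    | tail _ h ih =>
      obtain ⟨t, rfl⟩ := ih
      exact ⟨t + 1, by rw [run_succ, next, Option.mem_def.1 h]; rfl⟩
  · rintro ⟨t, ht⟩
    exact Part.dom_iff_mem (o := StateTransition.eval (step M) (init w)).2
      ⟨_, StateTransition.mem_eval.2 ⟨reaches_run M w t, ht⟩⟩

/-- The action of the machine in state `q` when it reads `h`. -/
def action (q : Λ) (h : Γ) : Option (Stmt Γ) := (M q h).map Prod.snd

/-- The state after one step from state `q` when the machine reads `h`. -/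
def target (q : Λ) (h : Γ) : Λ := ((M q h).map Prod.fst).getD q

/-- The effect of an action on the tape contents around the head. -/
def update : Option (Stmt Γ) → (ℤ → Γ) → ℤ → Γ
  | none, τ => τ
  | some (.move Dir.left), τ => fun i => τ (i - 1)
  | some (.move Dir.right), τ => fun i => τ (i + 1)
  | some (.write b), τ => Function.update τ 0 b

theorem update_left {Γ : Type} {τ : ℤ → Γ} {i k : ℤ} (h : i - 1 = k) :
    update (some (.move Dir.left)) τ i = τ k := congrArg τ h

theorem update_right {Γ : Type} {τ : ℤ → Γ} {i k : ℤ} (h : i + 1 = k) :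
    update (some (.move Dir.right)) τ i = τ k := congrArg τ h

theorem next_q (c : Cfg Γ Λ) : (next M c).q = target M c.q (c.Tape.nth 0) := by
  obtain ⟨q, T⟩ := c
  simp only [next, step, target, Tape.nth_zero]
  cases M q T.head <;> rfl

theorem next_nth (c : Cfg Γ Λ) :
    (next M c).Tape.nth = update (action M c.q (c.Tape.nth 0)) c.Tape.nth := by
  obtain ⟨q, T⟩ := c
  simp only [next, step, action, Tape.nth_zero]
  rcases M q T.head with _ | ⟨q', d | b⟩
  · rfl
  · cases d
    · funext i; exact Tape.move_left_nth T i
    · funext i; exact Tape.move_right_nth T i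
  · funext i
    exact (Tape.write_nth b T).trans (by simp [update, Function.update_apply])

theorem step_eq_none (c : Cfg Γ Λ) : step M c = none ↔ M c.q (c.Tape.nth 0) = none := by
  obtain ⟨q, T⟩ := c
  simp [step, Tape.nth_zero]

theorem init_nth_natCast (w : List Γ) (j : ℕ) :
    (init w : Cfg Γ Λ).Tape.nth j = w.getI j := by
  simp [init, Tape.mk₁, Tape.mk₂, Tape.mk'_nth_nat]

theorem init_nth_neg (w : List Γ) (j : ℕ) :
    (init w : Cfg Γ Λ).Tape.nth (-1 - j) = default := by
  rw [show (-1 - j : ℤ) = Int.negSucc j by omega]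
  simp [init, Tape.mk₁, Tape.mk₂, Tape.mk', Tape.nth]

/-- A tile shows the cell at distance `j` to the left of the head and the cell `j` places to the
right of it, their contents after the next step, and the state and the scanned symbol. -/
structure RunTile (Γ : Type) {Λ : Type} (S : Finset Λ) where
  first : Bool
  init : Bool
  head : Γ
  q : S
  l : Γ
  x : Γ
  nq : S
  nl : Γ
  nx : Γ

instance (S : Finset Λ) [Finite Γ] : Finite (RunTile Γ S) :=
  Finite.of_injective (fun t => (t.first, t.init, t.head, t.q, t.l, t.x, t.nq, t.nl, t.nx)) (by
    rintro ⟨⟩ ⟨⟩ h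
    simpa using h)

variable {S : Finset Λ}

/-- Consistency of the first tile of a row. -/
def corner : Option (Stmt Γ) → RunTile Γ S → Prop
  | none, t => t.nl = t.l ∧ t.nx = t.x
  | some (.move Dir.left), t => t.nx = t.l
  | some (.move Dir.right), t => t.nl = t.x
  | some (.write b), t => t.nl = t.l ∧ t.nx = b

/-- Consistency of neighbours in a row. -/
def inner : Option (Stmt Γ) → RunTile Γ S → RunTile Γ S → Prop
  | some (.move Dir.left), t, t' => t'.nx = t.x ∧ t.nl = t'.l
  | some (.move Dir.right), t, t' => t'.nl = t.l ∧ t.nx = t'.x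
  | _, _, t' => t'.nl = t'.l ∧ t'.nx = t'.x

/-- Consistency of the last tile of a row. -/
def border : Option (Stmt Γ) → RunTile Γ S → Prop
  | some (.move Dir.left), t => t.nl = default ∧ t.x = default
  | some (.move Dir.right), t => t.nx = default ∧ t.l = default
  | _, _ => True

/-- The tile system whose rows are the configurations of `M`. -/
def tileSystem [Finite Γ] (S : Finset Λ) : TileSystem Γ where
  Tile := RunTile Γ S
  finite := inferInstance
  horiz t t' :=
    (t.first = true → t.head = t.x ∧ corner (action M t.q t.head) t) ∧
    (t.nq : Λ) = target M t.q t.head ∧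
    (t'.first = true → t'.init = false ∧ border (action M t.q t.head) t) ∧
    (t'.first = false → t'.head = t.head ∧ t'.q = t.q ∧ inner (action M t.q t.head) t t')
  vert t t' := t'.init = false ∧ t'.first = t.first ∧ t'.q = t.nq ∧ t'.l = t.nl ∧ t'.x = t.nx
  start t := t.first = true
  init t := t.init = true ∧ (t.q : Λ) = default ∧ t.l = default
  acc t := t.init = false ∧ M t.q t.head = none
  letter a t := t.init = true ∧ t.x = a
  blank t := t.init = true → t.x = default

/-! ### From tilings to halting runs -/

section Soundness

variable [Finite Γ] {M} {w : List Γ} {W m : ℕ} {f : ℕ → RunTile Γ S}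

/-- Row `t` of the tiling is the configuration after `t` steps. -/
structure RowCorrect (M : Machine Γ Λ) (w : List Γ) (W m : ℕ) (f : ℕ → RunTile Γ S) (t : ℕ) :
    Prop where
  first (j : ℕ) : j < W → t * W + j ≤ m → ((f (t * W + j)).first = true ↔ j = 0)
  q (j : ℕ) : j < W → t * W + j ≤ m → ((f (t * W + j)).q : Λ) = (run M w t).q
  l (j : ℕ) : j < W → t * W + j ≤ m → (f (t * W + j)).l = (run M w t).Tape.nth (-1 - j)
  x (j : ℕ) : j < W → t * W + j ≤ m → (f (t * W + j)).x = (run M w t).Tape.nth j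
  left_blank (j : ℕ) : W ≤ j → (run M w t).Tape.nth (-1 - j) = default
  right_blank (j : ℕ) : W ≤ j → (run M w t).Tape.nth j = default

/-- The scanned symbol is tied to cell 0 at the first tile of the row and then handed on from tile
to tile. -/
theorem RowCorrect.head {t : ℕ} (hr : RowCorrect M w W m f t)
    (hf : (tileSystem M S).Tiles w W m f) (j : ℕ) (hj : j < W) (hm : t * W + j ≤ m) :
    (f (t * W + j)).head = (run M w t).Tape.nth 0 := by
  induction j with
  | zero =>
    rw [((hf.horiz _).1 ((hr.first 0 hj hm).2 rfl)).1, hr.x 0 hj hm, Nat.cast_zero]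
  | succ j ih =>
    rw [← ih (by omega) (by omega)]
    have h := (hr.first (j + 1) hj hm).not.2 (by omega)
    exact ((hf.horiz (t * W + j)).2.2.2 (Bool.eq_false_iff.2 h)).1

/-- Inside the first row the tiles are initial, and `horiz` forbids an initial tile to be the first
of a row, so only position 0 is marked `first`. -/
theorem rowCorrect_zero (hf : (tileSystem M S).Tiles w W m f) (hW : W ≤ m) :
    RowCorrect M w W m f 0 := by
  -- Tiles carrying input letters are initial, whereas the tile at position `W` lies above another
  -- one and is not. Hence the input fits into one row.
  have hw : w.length ≤ W := by
    by_contra h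
    have h1 := (hf.letter W (by omega)).1
    have h2 := (hf.vert 0 (by omega)).1
    simp only [zero_add] at h2
    simp [h1] at h2
  constructor
  · intro j hj hm
    rw [zero_mul, zero_add]
    rcases j with _ | j
    · exact iff_of_true hf.start rfl
    · simp only [Nat.add_eq_zero_iff, one_ne_zero, and_false, iff_false]
      intro h
      have h1 := ((hf.horiz j).2.2.1 h).1
      simp [(hf.init (j + 1) hj (by omega)).1] at h1
  · intro j hj hm
    rw [zero_mul, zero_add]
    exact (hf.init j hj (by omega)).2.1
  · intro j hj hm
    rw [zero_mul, zero_add, (hf.init j hj (by omega)).2.2]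
    exact (init_nth_neg w j).symm
  · intro j hj hm
    rw [zero_mul, zero_add]
    refine Eq.trans ?_ (init_nth_natCast w j).symm
    by_cases h : j < w.length
    · rw [(hf.letter j h).2, List.getI_eq_getElem _ h]
    · rw [hf.blank j (by omega) (hf.init j hj (by omega)).1, List.getI_eq_default _ (by omega)]
  · intro j _
    exact init_nth_neg w j
  · intro j hj
    exact (init_nth_natCast w j).trans (List.getI_eq_default _ (by omega))

/-- Every tile predicts the contents of its two cells after the step. The prediction is checked
against horizontal neighbours within row `t`, and the vertical condition copies it into row `t + 1`.
-/
theorem RowCorrect.succ {t : ℕ} (hr : RowCorrect M w W m f t)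
    (hf : (tileSystem M S).Tiles w W m f) (ht : (t + 1) * W ≤ m) :
    RowCorrect M w W m f (t + 1) := by
  have hidx (j : ℕ) : (t + 1) * W + j = t * W + j + W := by ring
  have hW := hf.pos
  set a := action M (run M w t).q ((run M w t).Tape.nth 0) with ha
  have hact (j : ℕ) (hj : j < W) (hm : t * W + j ≤ m) :
      action M (f (t * W + j)).q (f (t * W + j)).head = a := by
    rw [hr.q j hj hm, hr.head hf j hj hm]
  have hv (j : ℕ) (hm : (t + 1) * W + j ≤ m) := hf.vert (t * W + j) (by rwa [← hidx])
  have hcorner : corner a (f (t * W)) := by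
    have := ((hf.horiz (t * W)).1 ((hr.first 0 hW (by lia)).2 rfl)).2
    rwa [show t * W = t * W + 0 from rfl, hact 0 hW (by lia)] at this
  have hinner (j : ℕ) (hj : j + 1 < W) (hm : t * W + (j + 1) ≤ m) :
      inner a (f (t * W + j)) (f (t * W + (j + 1))) := by
    have h := (hr.first (j + 1) hj hm).not.2 (by omega)
    have := ((hf.horiz (t * W + j)).2.2.2 (Bool.eq_false_iff.2 h)).2.2
    rwa [hact j (by omega) (by omega)] at this
  -- The mark `first` is copied vertically, so the tile after the last one of row `t` is a first
  -- tile; this is how the last tile is recognised without knowing `W`.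
  have hborder : border a (f (t * W + (W - 1))) := by
    have h1 : (f ((t + 1) * W)).first = true := by
      have h := (hv 0 (by omega)).2.1
      rw [← hidx] at h
      exact h.trans ((hr.first 0 hW (by lia)).2 rfl)
    have h2 := hf.horiz (t * W + (W - 1))
    rw [show t * W + (W - 1) + 1 = (t + 1) * W by lia] at h2
    have := (h2.2.2.1 h1).2
    rwa [hact (W - 1) (by omega) (by lia)] at this
  have hnth : (run M w (t + 1)).Tape.nth = update a (run M w t).Tape.nth := by
    rw [run_succ, next_nth]
  have hl0 := hr.l 0 hW (by lia)
  have hx0 := hr.x 0 hW (by lia)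
  have hlW := hr.l (W - 1) (by omega) (by lia)
  have hxW := hr.x (W - 1) (by omega) (by lia)
  refine ⟨fun j hj hm => ?_, fun j hj hm => ?_, fun j hj hm => ?_, fun j hj hm => ?_,
    fun j hj => ?_, fun j hj => ?_⟩
  · have hm' := hm
    rw [hidx] at hm' ⊢
    rw [(hv j hm).2.1]
    exact hr.first j hj (by omega)
  · have hm' := hm
    rw [hidx] at hm' ⊢
    rw [(hv j hm).2.2.1, (hf.horiz _).2.1, run_succ, next_q, hr.q j hj (by omega),
      hr.head hf j hj (by omega)]
  · have hm' := hm
    rw [hidx] at hm' ⊢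
    rw [(hv j hm).2.2.2.1, hnth]
    have hl (i : ℕ) (hi : i < W) (hi' : i ≤ j + 1) := hr.l i hi (by omega)
    have hin (i : ℕ) (hi : i + 1 < W) (hi' : i ≤ j) := hinner i hi (by omega)
    clear_value a
    rcases a with _ | ⟨_ | _⟩ | b
    · rcases j with _ | j
      · exact hcorner.1.trans hl0
      · exact (hin j hj (by omega)).1.trans (hl _ hj (by omega))
    · rcases lt_or_eq_of_le (Nat.succ_le_of_lt hj) with h | h
      · rw [(hin j h le_rfl).2, hl _ h le_rfl]
        exact (update_left (by omega)).symm
      -- At the last column the incoming cell lies beyond the row and is blank by the invariant.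
      · obtain rfl : j = W - 1 := by omega
        rw [hborder.1, ← hr.left_blank W le_rfl]
        exact (update_left (by omega)).symm
    · rcases j with _ | j
      · exact hcorner.trans hx0
      · rw [(hin j hj (by omega)).1, hl _ (by omega) (by omega)]
        exact (update_right (by omega)).symm
    · have hne : (-1 - j : ℤ) ≠ 0 := by omega
      simp only [update, Function.update_of_ne hne]
      rcases j with _ | j
      · exact hcorner.1.trans hl0
      · exact (hin j hj (by omega)).1.trans (hl _ hj (by omega))
  · have hm' := hm
    rw [hidx] at hm' ⊢
    rw [(hv j hm).2.2.2.2, hnth]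
    have hx (i : ℕ) (hi : i < W) (hi' : i ≤ j + 1) := hr.x i hi (by omega)
    have hin (i : ℕ) (hi : i + 1 < W) (hi' : i ≤ j) := hinner i hi (by omega)
    clear_value a
    rcases a with _ | ⟨_ | _⟩ | b
    · rcases j with _ | j
      · exact hcorner.2.trans hx0
      · exact (hin j hj (by omega)).2.trans (hx _ hj (by omega))
    · rcases j with _ | j
      · exact hcorner.trans hl0
      · rw [(hin j hj (by omega)).1, hx _ (by omega) (by omega)]
        exact (update_left (by omega)).symm
    · rcases lt_or_eq_of_le (Nat.succ_le_of_lt hj) with h | h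
      · rw [(hin j h le_rfl).2, hx _ h le_rfl]
        exact (update_right (by omega)).symm
      · obtain rfl : j = W - 1 := by omega
        rw [hborder.1, ← hr.right_blank W le_rfl]
        exact (update_right (by omega)).symm
    · rcases j with _ | j
      · exact hcorner.2.trans (by simp [update])
      · have hne : ((j + 1 : ℕ) : ℤ) ≠ 0 := by omega
        simp only [update, Function.update_of_ne hne]
        exact (hin j hj (by omega)).2.trans (hx _ hj (by omega))
  · rw [hnth]
    clear_value a
    rcases a with _ | ⟨_ | _⟩ | b
    · exact hr.left_blank j hj
    · exact (update_left (by omega)).trans (hr.left_blank (j + 1) (by omega))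
    · rcases hj.lt_or_eq with h | rfl
      · exact (update_right (by omega)).trans (hr.left_blank (j - 1) (by omega))
      -- The cell that leaves the row is the last one on the left, which `border` requires to be
      -- blank.
      · exact (update_right (by omega)).trans (hlW.symm.trans hborder.2)
    · have hne : (-1 - j : ℤ) ≠ 0 := by omega
      simp only [update, Function.update_of_ne hne]
      exact hr.left_blank j hj
  · rw [hnth]
    clear_value a
    rcases a with _ | ⟨_ | _⟩ | b
    · exact hr.right_blank j hj
    · rcases hj.lt_or_eq with h | rfl
      · exact (update_left (by omega)).trans (hr.right_blank (j - 1) (by omega))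
      · exact (update_left (by omega)).trans (hxW.symm.trans hborder.2)
    · exact (update_right (by omega)).trans (hr.right_blank (j + 1) (by omega))
    · have hne : (j : ℤ) ≠ 0 := by omega
      simp only [update, Function.update_of_ne hne]
      exact hr.right_blank j hj

/-- The accepting tile at position `m` lies in row `m / W`, and it shows a state and a scanned
symbol for which the machine has no instruction. -/
theorem eval_dom_of_tiles (hf : (tileSystem M S).Tiles w W m f) : (eval M w).Dom := by
  -- Accepting tiles are not initial, so the accepting tile lies beyond the first row.
  have hW : W ≤ m := by
    by_contra h
    have h1 := (hf.init m (by omega) le_rfl).1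
    rw [hf.acc.1] at h1
    exact Bool.false_ne_true h1
  have hrow (t : ℕ) (ht : t * W ≤ m) : RowCorrect M w W m f t := by
    induction t with
    | zero => exact rowCorrect_zero hf hW
    | succ t ih => exact (ih (by lia)).succ hf ht
  have hpos := hf.pos
  have hlt := Nat.mod_lt m hpos
  have hdm : m / W * W + m % W = m := Nat.div_add_mod' m W
  have hr := hrow (m / W) (Nat.div_mul_le_self m W)
  have hq := hr.q _ hlt hdm.le
  have hh := hr.head hf _ hlt hdm.le
  rw [hdm] at hq hh
  refine (eval_dom_iff M w).2 ⟨m / W, (step_eq_none M _).2 ?_⟩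
  rw [← hq, ← hh]
  exact hf.acc.2

end Soundness

/-! ### From halting runs to tilings -/

section Completeness

variable {M} {w : List Γ}

theorem run_mem (hS : Supports M (S : Set Λ)) (w : List Γ) (t : ℕ) : (run M w t).q ∈ S := by
  induction t with
  | zero => exact hS.1
  | succ t ih =>
    rw [run_succ, next]
    cases h : step M (run M w t) with
    | none => exact ih
    | some c => exact step_supports M hS h ih

/-- One step shifts the tape by at most one cell, or writes only at position 0. -/
theorem run_blank (w : List Γ) (t : ℕ) {j : ℕ} (hj : w.length + t ≤ j) :
    (run M w t).Tape.nth (-1 - j) = default ∧ (run M w t).Tape.nth j = default := by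
  induction t generalizing j with
  | zero =>
    exact ⟨init_nth_neg w j, (init_nth_natCast w j).trans (List.getI_eq_default _ hj)⟩
  | succ t ih =>
    rw [run_succ, next_nth]
    obtain ⟨i, rfl⟩ : ∃ i, j = i + 1 := ⟨j - 1, by omega⟩
    have h0 := ih (j := i) (by omega)
    have h1 := ih (j := i + 1) (by omega)
    have h2 := ih (j := i + 1 + 1) (by omega)
    rcases action M (run M w t).q ((run M w t).Tape.nth 0) with _ | ⟨_ | _⟩ | b
    · exact h1
    · exact ⟨(update_left (by omega)).trans h2.1, (update_left (by omega)).trans h0.2⟩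
    · exact ⟨(update_right (by omega)).trans h0.1, (update_right (by omega)).trans h2.2⟩
    · have hne : (-1 - (i + 1 : ℕ) : ℤ) ≠ 0 := by omega
      have hne' : ((i + 1 : ℕ) : ℤ) ≠ 0 := by omega
      simp only [update, Function.update_of_ne hne, Function.update_of_ne hne']
      exact h1

theorem run_eq_of_halted {t₀ : ℕ} (h : step M (run M w t₀) = none) {t : ℕ} (ht : t₀ ≤ t) :
    run M w t = run M w t₀ := by
  induction t, ht using Nat.le_induction with
  | base => rfl
  | succ t _ ih => rw [run_succ, ih, next, h, Option.getD_none]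

/-- The tile in column `j` of row `t`. -/
def runTile (hS : Supports M (S : Set Λ)) (w : List Γ) (t j : ℕ) : RunTile Γ S where
  first := decide (j = 0)
  init := decide (t = 0)
  head := (run M w t).Tape.nth 0
  q := ⟨(run M w t).q, run_mem hS w t⟩
  l := (run M w t).Tape.nth (-1 - j)
  x := (run M w t).Tape.nth j
  nq := ⟨(run M w (t + 1)).q, run_mem hS w (t + 1)⟩
  nl := (run M w (t + 1)).Tape.nth (-1 - j)
  nx := (run M w (t + 1)).Tape.nth j

theorem corner_runTile (hS : Supports M (S : Set Λ)) (t : ℕ) :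
    corner (action M (run M w t).q ((run M w t).Tape.nth 0)) (runTile hS w t 0) := by
  have h := next_nth M (run M w t)
  rw [← run_succ] at h
  rcases ha : action M (run M w t).q ((run M w t).Tape.nth 0) with _ | ⟨_ | _⟩ | b <;>
    rw [ha] at h <;> simp only [corner, runTile, h]
  · exact ⟨rfl, rfl⟩
  · exact update_left (by omega)
  · exact update_right (by omega)
  · simp [update]

theorem inner_runTile (hS : Supports M (S : Set Λ)) (t j : ℕ) :
    inner (action M (run M w t).q ((run M w t).Tape.nth 0)) (runTile hS w t j)
      (runTile hS w t (j + 1)) := by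
  have h := next_nth M (run M w t)
  rw [← run_succ] at h
  rcases ha : action M (run M w t).q ((run M w t).Tape.nth 0) with _ | ⟨_ | _⟩ | b <;>
    rw [ha] at h <;> simp only [inner, runTile, h]
  · exact ⟨rfl, rfl⟩
  · exact ⟨update_left (by omega), update_left (by omega)⟩
  · exact ⟨update_right (by omega), update_right (by omega)⟩
  · have hne : (-1 - (j + 1 : ℕ) : ℤ) ≠ 0 := by omega
    have hne' : ((j + 1 : ℕ) : ℤ) ≠ 0 := by omega
    simp only [update, Function.update_of_ne hne,
      Function.update_of_ne hne', and_self]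

theorem border_runTile (hS : Supports M (S : Set Λ)) (t j : ℕ)
    (hb : ∀ k > j, (run M w t).Tape.nth k = default ∧ (run M w t).Tape.nth (-1 - k) = default)
    (hj : (run M w t).Tape.nth j = default) (hj' : (run M w t).Tape.nth (-1 - j) = default) :
    border (action M (run M w t).q ((run M w t).Tape.nth 0)) (runTile hS w t j) := by
  have h := next_nth M (run M w t)
  rw [← run_succ] at h
  have h2 := hb (j + 1) (by omega)
  rcases ha : action M (run M w t).q ((run M w t).Tape.nth 0) with _ | ⟨_ | _⟩ | b
  · trivial
  · simp only [border, runTile, h, ha]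
    exact ⟨(update_left (by omega)).trans h2.2, hj⟩
  · simp only [border, runTile, h, ha]
    exact ⟨(update_right (by omega)).trans h2.1, hj'⟩
  · trivial

/-- After halting the last configuration is repeated, so the rows can be continued forever. -/
theorem exists_tilesForever [Finite Γ] (hS : Supports M (S : Set Λ)) (h : (eval M w).Dom) :
    ∃ W m f, (tileSystem M S).TilesForever w W m f := by
  obtain ⟨t₀, ht₀⟩ := (eval_dom_iff M w).1 h
  -- After at most `t₀` moves all cells at distance `w.length + t₀` or more are blank. The extra
  -- column keeps the last tile of each row blank, as `border` demands.
  set W := w.length + t₀ + 1 with hW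
  have hW0 : 0 < W := by omega
  have hblank (t j : ℕ) (hj : w.length + t₀ ≤ j) :
      (run M w t).Tape.nth j = default ∧ (run M w t).Tape.nth (-1 - j) = default := by
    rcases le_total t t₀ with ht | ht
    · exact (run_blank w t (by omega)).symm
    · rw [run_eq_of_halted ht₀ ht]
      exact (run_blank w t₀ hj).symm
  -- Row `t₀ + 1` rather than `t₀`, because accepting tiles must not be initial even when `t₀ = 0`.
  refine ⟨W, (t₀ + 1) * W, fun i => runTile hS w (i / W) (i % W), hW0, fun i => ?_, fun i => ?_,
    fun i hi => ?_, fun i hi => ?_, ?_, fun i hi => ?_, fun i hi => ?_⟩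
  · have hmod := Nat.mod_lt i hW0
    refine ⟨fun hi => ?_, ?_, ?_⟩
    · have hi : i % W = 0 := by simpa [runTile] using hi
      rw [hi]
      exact ⟨by simp [runTile], corner_runTile hS _⟩
    · exact (congrArg Cfg.q (run_succ M w _)).trans (next_q M _)
    · have hdm := Nat.div_add_mod' i W
      rcases lt_or_eq_of_le (Nat.succ_le_of_lt hmod) with hlt | heq
      · obtain ⟨h1, h2⟩ : (i + 1) / W = i / W ∧ (i + 1) % W = i % W + 1 :=
          (Nat.div_mod_unique hW0).2 ⟨by lia, hlt⟩
        rw [h1, h2]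
        refine ⟨fun h => ?_, fun _ => ⟨rfl, rfl, inner_runTile hS _ _⟩⟩
        simp [runTile] at h
      · obtain ⟨h1, h2⟩ : (i + 1) / W = i / W + 1 ∧ (i + 1) % W = 0 :=
          (Nat.div_mod_unique hW0).2 ⟨by lia, hW0⟩
        rw [h1, h2]
        refine ⟨fun _ => ⟨by simp [runTile], border_runTile hS _ _ ?_ ?_ ?_⟩, fun h => ?_⟩
        · exact fun k hk => hblank _ _ (by omega)
        · exact (hblank _ _ (by omega)).1
        · exact (hblank _ _ (by omega)).2
        · simp [runTile] at h
  · have h1 : (i + W) / W = i / W + 1 := Nat.add_div_right i hW0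
    have h2 : (i + W) % W = i % W := Nat.add_mod_right i W
    rw [h1, h2]
    exact ⟨by simp [runTile], rfl, rfl, rfl, rfl⟩
  · rw [Nat.div_eq_of_lt hi, Nat.mod_eq_of_lt hi]
    exact ⟨rfl, rfl, init_nth_neg w i⟩
  · have hi : t₀ + 1 ≤ i / W := (Nat.le_div_iff_mul_le hW0).2 hi
    refine ⟨decide_eq_false (by omega), ?_⟩
    have := (step_eq_none M _).1 ht₀
    rwa [← run_eq_of_halted ht₀ (show t₀ ≤ i / W by omega)] at this
  · simp [tileSystem, runTile]
  · rw [Nat.div_eq_of_lt (by omega), Nat.mod_eq_of_lt (by omega)]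
    exact ⟨rfl, (init_nth_natCast w i).trans (List.getI_eq_getElem _ hi)⟩
  · intro h0
    have h0 : i / W = 0 := by simpa [runTile] using h0
    have hlt : i < W := by
      rcases Nat.div_eq_zero_iff.1 h0 with h | h <;> omega
    simp only [h0, Nat.mod_eq_of_lt hlt]
    exact (init_nth_natCast w i).trans (List.getI_eq_default _ hi)

end Completeness

end Turing.TM0

/-! ### Visibly-pushdown automata for the two path languages -/

namespace ALCO

namespace VPA

/-- An automaton for `(r + s)*`. -/
def anyPath (r s : RoleName) : VPA where
  initials := [0]
  finals := [0]
  calls := [(0, r, 0, 0)]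
  internals := []
  returns := [(0, s, some 0, 0), (0, s, none, 0)]

/-- An automaton for `{rⁿ sⁿ | n ≥ 0}`; the stack symbol `1` marks the bottom of the stack. -/
def counting (r s : RoleName) : VPA where
  initials := [0]
  finals := [0, 3]
  calls := [(0, r, 1, 1), (1, r, 1, 0)]
  internals := []
  returns := [(1, s, some 0, 2), (1, s, some 1, 3), (2, s, some 0, 2), (2, s, some 1, 3)]

variable {r s : RoleName}

theorem isOver_anyPath {κ : RoleName → LetterKind} (hr : κ r = LetterKind.call)
    (hs : κ s = LetterKind.ret) : (anyPath r s).IsOver κ := by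
  simp [IsOver, anyPath, hr, hs]

theorem isOver_counting {κ : RoleName → LetterKind} (hr : κ r = LetterKind.call)
    (hs : κ s = LetterKind.ret) : (counting r s).IsOver κ := by
  simp [IsOver, counting, hr, hs]

theorem steps_anyPath_state {w : List Letter} {c c' : ℕ × List ℕ}
    (h : (anyPath r s).Steps w c c') : ∀ a ∈ w, a = Letter.role r ∨ a = Letter.role s := by
  induction w generalizing c with
  | nil => simp
  | cons a w ih =>
    obtain ⟨d, h1, h2⟩ := h
    rw [List.forall_mem_cons]
    refine ⟨?_, ih h2⟩
    cases h1 <;> simp_all [anyPath]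

/-- An unmatched `s` is read by the bottom transition, so no word gets stuck. The stack height has
to vary in the induction. -/
theorem exists_steps_anyPath {w : List Letter}
    (h : ∀ a ∈ w, a = Letter.role r ∨ a = Letter.role s) (k : ℕ) :
    ∃ σ, (anyPath r s).Steps w (0, List.replicate k 0) (0, σ) := by
  induction w generalizing k with
  | nil => exact ⟨_, rfl⟩
  | cons a w ih =>
    rw [List.forall_mem_cons] at h
    obtain ⟨rfl | rfl, hw⟩ := h
    · obtain ⟨σ, hσ⟩ := ih hw (k + 1)
      exact ⟨σ, _, .call 0 0 0 r _ (by simp [anyPath]), hσ⟩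
    · cases k with
      | zero =>
        obtain ⟨σ, hσ⟩ := ih hw 0
        exact ⟨σ, _, .bottom 0 0 s (by simp [anyPath]), hσ⟩
      | succ k =>
        obtain ⟨σ, hσ⟩ := ih hw k
        exact ⟨σ, _, .pop 0 0 0 s _ (by simp [anyPath]), hσ⟩

theorem mem_language_anyPath {w : List Letter} :
    w ∈ (anyPath r s).language ↔ ∀ a ∈ w, a = Letter.role r ∨ a = Letter.role s := by
  constructor
  · rintro ⟨_, _, _, _, _, h⟩
    exact steps_anyPath_state h
  · intro h
    obtain ⟨σ, hσ⟩ := exists_steps_anyPath h 0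
    exact ⟨0, by simp [anyPath], 0, by simp [anyPath], σ, hσ⟩

theorem language_anyPath : (anyPath r s).language =
    (({[Letter.role r]} : Language Letter) + ({[Letter.role s]} : Language Letter))∗ := by
  ext w
  rw [mem_language_anyPath, Language.mem_kstar]
  constructor
  · intro h
    refine ⟨w.map fun a => [a], by rw [← List.flatMap_def, List.flatMap_singleton'], fun y hy => ?_⟩
    obtain ⟨a, ha, rfl⟩ := List.mem_map.1 hy
    rcases h a ha with rfl | rfl
    · exact Or.inl rfl
    · exact Or.inr rfl
  · rintro ⟨L, rfl, hL⟩ a ha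
    obtain ⟨y, hy, ha⟩ := List.mem_flatten.1 ha
    rcases hL y hy with h | h
    · obtain rfl : y = [Letter.role r] := h
      exact Or.inl (List.mem_singleton.1 ha)
    · obtain rfl : y = [Letter.role s] := h
      exact Or.inr (List.mem_singleton.1 ha)

theorem step_counting {a : Letter} {q : ℕ} {σ : List ℕ} {d : ℕ × List ℕ}
    (h : (counting r s).Step a (q, σ) d) :
    (a = Letter.role r ∧ (q = 0 ∧ d = (1, 1 :: σ) ∨ q = 1 ∧ d = (1, 0 :: σ))) ∨
    (a = Letter.role s ∧ (q = 1 ∨ q = 2) ∧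
      ∃ τ, σ = 0 :: τ ∧ d = (2, τ) ∨ σ = 1 :: τ ∧ d = (3, τ)) := by
  cases h with
  | call _ _ _ _ _ h =>
    simp only [counting, List.mem_cons, Prod.mk.injEq, List.not_mem_nil, or_false] at h
    rcases h with ⟨rfl, rfl, rfl, rfl⟩ | ⟨rfl, rfl, rfl, rfl⟩ <;> simp
  | internal _ _ _ _ h => simp [counting] at h
  | pop _ _ _ _ _ h =>
    simp only [counting, List.mem_cons, Prod.mk.injEq, Option.some.injEq, List.not_mem_nil,
      or_false] at h
    rcases h with ⟨rfl, rfl, rfl, rfl⟩ | ⟨rfl, rfl, rfl, rfl⟩ | ⟨rfl, rfl, rfl, rfl⟩ |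
      ⟨rfl, rfl, rfl, rfl⟩ <;> simp
  | bottom _ _ _ h => simp [counting] at h

theorem steps_counting_three {w : List Letter} {σ : List ℕ} {c : ℕ × List ℕ}
    (h : (counting r s).Steps w (3, σ) c) : w = [] := by
  cases w with
  | nil => rfl
  | cons a w =>
    obtain ⟨d, h1, -⟩ := h
    rcases step_counting h1 with ⟨-, ⟨h, -⟩ | ⟨h, -⟩⟩ | ⟨-, h, -⟩ <;> omega

/-- States 1 and 2 treat `s` alike: a `0` on top leads to state 2, and the marker `1` leads to the
dead end 3. This is the common case of the next two lemmas. -/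
theorem steps_counting_return {w : List Letter} {k q : ℕ} {a : Letter} {σ : List ℕ}
    {d : ℕ × List ℕ} (ha : a = Letter.role s)
    (hd : ∃ τ, List.replicate k 0 ++ [1] = 0 :: τ ∧ d = (2, τ) ∨
      List.replicate k 0 ++ [1] = 1 :: τ ∧ d = (3, τ))
    (h : (counting r s).Steps w d (q, σ))
    (ih : ∀ k, (counting r s).Steps w (2, List.replicate k 0 ++ [1]) (q, σ) →
      w = List.replicate (k + 1) (Letter.role s)) :
    a :: w = List.replicate (k + 1) (Letter.role s) := by
  obtain ⟨τ, ⟨h1, rfl⟩ | ⟨h1, rfl⟩⟩ := hd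
  · cases k with
    | zero => simp at h1
    | succ k =>
      rw [List.replicate_succ, List.cons_append, List.cons.injEq] at h1
      rw [← h1.2] at h
      rw [ha, ih k h, ← List.replicate_succ]
  · cases k with
    | zero => rw [steps_counting_three h, ha]; rfl
    | succ k => simp [List.replicate_succ] at h1

theorem steps_counting_two {w : List Letter} {k q : ℕ} {σ : List ℕ}
    (h : (counting r s).Steps w (2, List.replicate k 0 ++ [1]) (q, σ)) (hq : q = 0 ∨ q = 3) :
    w = List.replicate (k + 1) (Letter.role s) := by
  induction w generalizing k with
  | nil => simp only [Steps, Prod.mk.injEq] at h; omega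
  | cons a w ih =>
    obtain ⟨d, h1, h2⟩ := h
    rcases step_counting h1 with ⟨-, ⟨h, -⟩ | ⟨h, -⟩⟩ | ⟨ha, -, hd⟩
    · omega
    · omega
    · exact steps_counting_return ha hd h2 fun k h => ih h

/-- The stack already holds `k + 1` symbols including the marker, all of which must be popped in
addition to the `n` symbols still to be pushed. -/
theorem steps_counting_one {w : List Letter} {k q : ℕ} {σ : List ℕ}
    (h : (counting r s).Steps w (1, List.replicate k 0 ++ [1]) (q, σ)) (hq : q = 0 ∨ q = 3) :
    ∃ n, w = List.replicate n (Letter.role r) ++ List.replicate (n + k + 1) (Letter.role s) := by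
  induction w generalizing k with
  | nil => simp only [Steps, Prod.mk.injEq] at h; omega
  | cons a w ih =>
    obtain ⟨d, h1, h2⟩ := h
    rcases step_counting h1 with ⟨ha, ⟨h, -⟩ | ⟨-, rfl⟩⟩ | ⟨ha, -, hd⟩
    · omega
    · obtain ⟨n, hn⟩ := ih (k := k + 1) h2
      refine ⟨n + 1, ?_⟩
      rw [hn, ha, show n + (k + 1) = n + 1 + k by ring]
      rfl
    · refine ⟨0, ?_⟩
      rw [List.replicate_zero, List.nil_append, zero_add]
      exact steps_counting_return ha hd h2 fun k h => steps_counting_two h hq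

theorem exists_steps_counting_two (k : ℕ) :
    (counting r s).Steps (List.replicate (k + 1) (Letter.role s))
      (2, List.replicate k 0 ++ [1]) (3, []) := by
  induction k with
  | zero => exact ⟨_, .pop 2 3 1 s [] (by simp [counting]), rfl⟩
  | succ k ih => exact ⟨_, .pop 2 2 0 s _ (by simp [counting]), ih⟩

theorem exists_steps_counting_one (n k : ℕ) :
    (counting r s).Steps
      (List.replicate n (Letter.role r) ++ List.replicate (n + k + 1) (Letter.role s))
      (1, List.replicate k 0 ++ [1]) (3, []) := by
  induction n generalizing k with
  | zero =>
    rw [zero_add]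
    cases k with
    | zero => exact ⟨_, .pop 1 3 1 s [] (by simp [counting]), rfl⟩
    | succ k => exact ⟨_, .pop 1 2 0 s _ (by simp [counting]), exists_steps_counting_two k⟩
  | succ n ih =>
    have := ih (k + 1)
    rw [show n + (k + 1) + 1 = n + 1 + k + 1 by ring] at this
    exact ⟨_, .call 1 1 0 r _ (by simp [counting]), this⟩

theorem language_counting : (counting r s).language = countingLanguage r s := by
  ext w
  constructor
  · rintro ⟨q₀, hq₀, q, hq, σ, h⟩
    obtain rfl : q₀ = 0 := by simpa [counting] using hq₀
    replace hq : q = 0 ∨ q = 3 := by simpa [counting] using hq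
    cases w with
    | nil => exact ⟨0, rfl⟩
    | cons a w =>
      obtain ⟨d, h1, h2⟩ := h
      rcases step_counting h1 with ⟨ha, ⟨-, rfl⟩ | ⟨h, -⟩⟩ | ⟨-, h, -⟩
      · obtain ⟨n, hn⟩ := steps_counting_one (k := 0) h2 hq
        exact ⟨n + 1, by rw [hn, ha]; rfl⟩
      · omega
      · omega
  · rintro ⟨n, rfl⟩
    refine ⟨0, by simp [counting], ?_⟩
    cases n with
    | zero => exact ⟨0, by simp [counting], [], rfl⟩
    | succ n =>
      exact ⟨3, by simp [counting], [], _, .call 0 1 1 r _ (by simp [counting]),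
        exists_steps_counting_one n 0⟩

end VPA

/-! ### Paths in interpretations and derived concept constructors -/

/-- `e` is reached from `d` by `n` steps of the relation `R`. -/
def StepsOf {α : Type} (R : α → α → Prop) : ℕ → α → α → Prop
  | 0, d, e => d = e
  | n + 1, d, e => ∃ d', R d d' ∧ StepsOf R n d' e

theorem StepsOf.snoc {α : Type} {R : α → α → Prop} {n : ℕ} {x y z : α} (h : StepsOf R n x y)
    (hyz : R y z) : StepsOf R (n + 1) x z := by
  induction n generalizing x with
  | zero => obtain rfl : x = y := h; exact ⟨z, hyz, rfl⟩
  | succ n ih =>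
    obtain ⟨x', h1, h2⟩ := h
    exact ⟨x', h1, ih h2⟩

theorem StepsOf.trans {α : Type} {R : α → α → Prop} {m n : ℕ} {x y z : α} (h : StepsOf R m x y)
    (hyz : StepsOf R n y z) : StepsOf R (m + n) x z := by
  induction m generalizing x with
  | zero => obtain rfl : x = y := h; rwa [zero_add]
  | succ m ih =>
    obtain ⟨x', h1, h2⟩ := h
    rw [Nat.add_right_comm]
    exact ⟨x', h1, ih h2⟩

namespace Interpretation

variable (I : Interpretation) (r s : RoleName)

/-- An edge labelled `r` or `s`. -/
def Edge (d e : I.Domain) : Prop := I.role r d e ∨ I.role s d e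

/-- Reachability along `r`-edges and `s`-edges. -/
def Connected : I.Domain → I.Domain → Prop := Relation.ReflTransGen (I.Edge r s)

/-- `e` is reached from `d` by some number of `r`-steps and the same number of `s`-steps. -/
def Sees (d e : I.Domain) : Prop :=
  ∃ n d', StepsOf (I.role r) n d d' ∧ StepsOf (I.role s) n d' e

variable {I r s}

theorem follows_append {v w : List Letter} {d e : I.Domain} :
    I.Follows (v ++ w) d e ↔ ∃ d', I.Follows v d d' ∧ I.Follows w d' e := by
  induction v generalizing d with
  | nil => simp [Follows]
  | cons a v ih => rcases a with a | a <;> simp [Follows, ih] <;> grind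

theorem follows_replicate {n : ℕ} {d e : I.Domain} :
    I.Follows (List.replicate n (Letter.role r)) d e ↔ StepsOf (I.role r) n d e := by
  induction n generalizing d with
  | zero => rfl
  | succ n ih => simp only [List.replicate_succ, Follows, StepsOf, ih]

theorem reaches_counting {d e : I.Domain} :
    I.Reaches (VPA.counting r s).language d e ↔ I.Sees r s d e := by
  rw [VPA.language_counting]
  constructor
  · rintro ⟨_, ⟨n, rfl⟩, h⟩
    obtain ⟨d', h1, h2⟩ := follows_append.1 h
    exact ⟨n, d', follows_replicate.1 h1, follows_replicate.1 h2⟩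
  · rintro ⟨n, d', h1, h2⟩
    exact ⟨_, ⟨n, rfl⟩, follows_append.2 ⟨d', follows_replicate.2 h1, follows_replicate.2 h2⟩⟩

theorem reaches_anyPath {d e : I.Domain} :
    I.Reaches (VPA.anyPath r s).language d e ↔ I.Connected r s d e := by
  constructor
  · rintro ⟨w, hw, h⟩
    rw [VPA.mem_language_anyPath] at hw
    induction w generalizing d with
    | nil => obtain rfl : d = e := h; exact .refl
    | cons a w ih =>
      rw [List.forall_mem_cons] at hw
      obtain ⟨rfl | rfl, hw⟩ := hw <;> obtain ⟨d', h1, h2⟩ := h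
      · exact .head (Or.inl h1) (ih hw h2)
      · exact .head (Or.inr h1) (ih hw h2)
  · intro h
    induction h using Relation.ReflTransGen.head_induction_on with
    | refl => exact ⟨[], VPA.mem_language_anyPath.2 (by simp), rfl⟩
    | head h _ ih =>
      obtain ⟨w, hw, hf⟩ := ih
      rw [VPA.mem_language_anyPath] at hw
      rcases h with h | h
      · exact ⟨Letter.role r :: w, VPA.mem_language_anyPath.2 (by simpa using hw), _, h, hf⟩
      · exact ⟨Letter.role s :: w, VPA.mem_language_anyPath.2 (by simpa using hw), _, h, hf⟩

end Interpretation

namespace Concept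

/-- Implication. -/
def imp (C D : Concept) : Concept := neg (inter C (neg D))

/-- Disjunction. -/
def union (C D : Concept) : Concept := imp (neg C) D

/-- Value restriction. -/
def allRole (ρ : RoleName) (C : Concept) : Concept := neg (existsRole ρ (neg C))

/-- Some element reachable by `r`-edges and `s`-edges satisfies `C`. -/
def somewhere (r s : RoleName) (C : Concept) : Concept := existsPath (VPA.anyPath r s) C

/-- All elements reachable by `r`-edges and `s`-edges satisfy `C`. -/
def everywhere (r s : RoleName) (C : Concept) : Concept := neg (somewhere r s (neg C))

/-- Some element reachable by a word `rⁿ sⁿ` satisfies `C`. -/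
def seesSome (r s : RoleName) (C : Concept) : Concept := existsPath (VPA.counting r s) C

/-- All elements reachable by words `rⁿ sⁿ` satisfy `C`. -/
def seesOnly (r s : RoleName) (C : Concept) : Concept := neg (seesSome r s (neg C))

/-- Finite conjunction. -/
def conj (l : List Concept) : Concept := l.foldr inter top

/-- The only role names are `r` and `s`, and the only path languages are `(r + s)*` and
`{rⁿ sⁿ | n ≥ 0}`. -/
def Basic (r s : RoleName) : Concept → Prop
  | top => True
  | atom _ => True
  | neg C => C.Basic r s
  | inter C D => C.Basic r s ∧ D.Basic r s
  | nominal _ => True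
  | existsRole ρ C => (ρ = r ∨ ρ = s) ∧ C.Basic r s
  | existsPath M C => (M = VPA.anyPath r s ∨ M = VPA.counting r s) ∧ C.Basic r s

theorem Basic.isVPL {κ : RoleName → LetterKind} {r s : RoleName} (hr : κ r = LetterKind.call)
    (hs : κ s = LetterKind.ret) {C : Concept} (h : C.Basic r s) : C.IsVPL κ := by
  induction C with
  | top | atom | nominal => trivial
  | neg C ih => exact ih h
  | inter C D ih ih' => exact ⟨ih h.1, ih' h.2⟩
  | existsRole ρ C ih => exact ih h.2
  | existsPath M C ih =>
    obtain ⟨rfl | rfl, h⟩ := h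
    · exact ⟨VPA.isOver_anyPath hr hs, ih h⟩
    · exact ⟨VPA.isOver_counting hr hs, ih h⟩

/-- Four of the nine languages suffice: `r`, `s`, `(r + s)*` and `{rⁿ sⁿ}`. -/
theorem Basic.usesOnly {r s : RoleName} {C : Concept} (h : C.Basic r s) :
    C.UsesOnly (nineLanguages r s) := by
  induction C with
  | top | atom | nominal => trivial
  | neg C ih => exact ih h
  | inter C D ih ih' => exact ⟨ih h.1, ih' h.2⟩
  | existsRole ρ C ih =>
    obtain ⟨rfl | rfl, h⟩ := h
    · exact ⟨by simp [nineLanguages], ih h⟩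
    · exact ⟨by simp [nineLanguages], ih h⟩
  | existsPath M C ih =>
    obtain ⟨rfl | rfl, h⟩ := h
    · exact ⟨by simp [nineLanguages, VPA.language_anyPath], ih h⟩
    · exact ⟨by simp [nineLanguages, VPA.language_counting], ih h⟩

section Basic

variable {r s : RoleName} {C D : Concept}

theorem basic_imp : (imp C D).Basic r s ↔ C.Basic r s ∧ D.Basic r s := .rfl

theorem basic_union : (union C D).Basic r s ↔ C.Basic r s ∧ D.Basic r s := .rfl

theorem basic_allRole {ρ : RoleName} :
    (allRole ρ C).Basic r s ↔ (ρ = r ∨ ρ = s) ∧ C.Basic r s := .rfl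

theorem basic_somewhere : (somewhere r s C).Basic r s ↔ C.Basic r s :=
  and_iff_right (Or.inl rfl)

theorem basic_everywhere : (everywhere r s C).Basic r s ↔ C.Basic r s :=
  and_iff_right (Or.inl rfl)

theorem basic_seesSome : (seesSome r s C).Basic r s ↔ C.Basic r s :=
  and_iff_right (Or.inr rfl)

theorem basic_seesOnly : (seesOnly r s C).Basic r s ↔ C.Basic r s :=
  and_iff_right (Or.inr rfl)

theorem basic_conj {l : List Concept} : (conj l).Basic r s ↔ ∀ C ∈ l, C.Basic r s := by
  induction l with
  | nil => simp [conj, Basic]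
  | cons C l ih => rw [List.forall_mem_cons, ← ih]; rfl

end Basic

end Concept

namespace Interpretation

open ALCO.Concept

variable {I : Interpretation} {r s ρ : RoleName} {C D : Concept} {d : I.Domain}

theorem mem_ext_top : d ∈ I.ext top := trivial

theorem mem_ext_atom {A : ConceptName} : d ∈ I.ext (atom A) ↔ d ∈ I.concept A := .rfl

theorem mem_ext_nominal {a : IndName} : d ∈ I.ext (nominal a) ↔ d = I.ind a := .rfl

theorem mem_ext_neg : d ∈ I.ext (neg C) ↔ d ∉ I.ext C := .rfl

theorem mem_ext_inter : d ∈ I.ext (inter C D) ↔ d ∈ I.ext C ∧ d ∈ I.ext D := .rfl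

theorem mem_ext_imp : d ∈ I.ext (imp C D) ↔ (d ∈ I.ext C → d ∈ I.ext D) := by
  simp [imp, mem_ext_neg, mem_ext_inter]

theorem mem_ext_union : d ∈ I.ext (union C D) ↔ d ∈ I.ext C ∨ d ∈ I.ext D := by
  simp [union, mem_ext_imp, mem_ext_neg, or_iff_not_imp_left]

theorem mem_ext_existsRole :
    d ∈ I.ext (existsRole ρ C) ↔ ∃ e, I.role ρ d e ∧ e ∈ I.ext C :=
  exists_congr fun _ => and_comm

theorem mem_ext_allRole : d ∈ I.ext (allRole ρ C) ↔ ∀ e, I.role ρ d e → e ∈ I.ext C := by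
  simp [allRole, mem_ext_neg, mem_ext_existsRole]

theorem mem_ext_somewhere :
    d ∈ I.ext (somewhere r s C) ↔ ∃ e, I.Connected r s d e ∧ e ∈ I.ext C :=
  exists_congr fun _ => and_comm.trans (and_congr_left' reaches_anyPath)

theorem mem_ext_everywhere :
    d ∈ I.ext (everywhere r s C) ↔ ∀ e, I.Connected r s d e → e ∈ I.ext C := by
  simp [everywhere, mem_ext_neg, mem_ext_somewhere]

theorem mem_ext_seesSome :
    d ∈ I.ext (seesSome r s C) ↔ ∃ e, I.Sees r s d e ∧ e ∈ I.ext C :=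
  exists_congr fun _ => and_comm.trans (and_congr_left' reaches_counting)

theorem mem_ext_seesOnly :
    d ∈ I.ext (seesOnly r s C) ↔ ∀ e, I.Sees r s d e → e ∈ I.ext C := by
  simp [seesOnly, mem_ext_neg, mem_ext_seesSome]

theorem mem_ext_conj {l : List Concept} : d ∈ I.ext (conj l) ↔ ∀ C ∈ l, d ∈ I.ext C := by
  induction l with
  | nil => simp [conj, mem_ext_top]
  | cons C l ih => rw [List.forall_mem_cons, ← ih]; rfl

end Interpretation

/-! ### The concept that describes a tiling -/

namespace Tiling

open ALCO.Concept ALCO.Interpretation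

variable {Γ : Type} (r s : RoleName) (𝒯 : TileSystem Γ)

/-- The label of the cells that follow the nominal `0`. -/
abbrev cell₀ : ℕ := 0

/-- The label of the cells that follow the nominal `1`. -/
abbrev cell₁ : ℕ := 1

/-- The label of the chain that compares consecutive rows. -/
abbrev rowChain : ℕ := 2

/-- The label of the chain that compares the two sequences of cells. -/
abbrev copyChain : ℕ := 3

/-- The label of the chain whose length is the circumference. -/
abbrev widthChain : ℕ := 4

/-- The concept name of a tile. -/
noncomputable def tileName (t : 𝒯.Tile) : ℕ :=
  haveI := 𝒯.finite
  5 + (Finite.equivFin 𝒯.Tile t : ℕ)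

theorem tileName_injective : Function.Injective (tileName 𝒯) := by
  have := 𝒯.finite
  intro t t' h
  simpa [tileName, Fin.val_inj] using h

/-- Keeps the tile names apart from the five structural labels 0 to 4. -/
theorem five_le_tileName (t : 𝒯.Tile) : 5 ≤ tileName 𝒯 t := Nat.le_add_right _ _

/-- The conjunction of a family of concepts indexed by the tiles. -/
noncomputable def allTiles (F : 𝒯.Tile → Concept) : Concept :=
  haveI := 𝒯.finite
  haveI := Fintype.ofFinite 𝒯.Tile
  conj (Finset.univ.toList.map F)

open Classical in
/-- The element carries only tiles from `P`. -/
noncomputable def only (P : 𝒯.Tile → Prop) : Concept :=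
  allTiles 𝒯 fun t => if P t then top else neg (atom (tileName 𝒯 t))

/-- The pairs of tiles seen in the two sequences of cells are related by `R`. -/
noncomputable def compare (R : 𝒯.Tile → 𝒯.Tile → Prop) : Concept :=
  allTiles 𝒯 fun t => imp (seesSome r s (inter (atom cell₀) (atom (tileName 𝒯 t))))
    (seesOnly r s (imp (atom cell₁) (only 𝒯 (R t))))

/-- A sequence of tiles starts at the nominal `a`; its cells have the label `A`. -/
noncomputable def sequenceRules (a : IndName) (A : ConceptName) : List Concept :=
  [imp (nominal a) (existsRole s top), imp (nominal a) (allRole s (atom A)),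
   imp (atom A) (existsRole s top), imp (atom A) (allRole s (atom A)),
   imp (atom A) (neg (only 𝒯 fun _ => False))]

/-- Elements labelled `A` form a chain of `r`-edges that ends in `B`. -/
def chainRule (A : ConceptName) (B : Concept) : Concept :=
  imp (atom A) (union B (inter (allRole s (neg top)) (allRole r (atom A))))

/-- The last element of the chain that compares rows. -/
def rowBase : Concept :=
  inter (existsRole r (nominal 0))
    (existsRole r (conj [atom widthChain, neg (nominal 1), somewhere r s (nominal 1)]))

/-- The last element of the chain that compares the two sequences of cells. -/
def copyBase : Concept := inter (existsRole r (nominal 0)) (existsRole r (nominal 1))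

/-- The conditions on all elements. -/
noncomputable def rules : List Concept :=
  sequenceRules s 𝒯 0 cell₀ ++ sequenceRules s 𝒯 1 cell₁ ++
  [imp (nominal 0) (allRole s (only 𝒯 𝒯.start)),
   imp (atom cell₀) (allTiles 𝒯 fun t =>
    imp (atom (tileName 𝒯 t)) (allRole s (only 𝒯 (𝒯.horiz t)))),
   chainRule r s rowChain (rowBase r s),
   imp (atom rowChain) (compare r s 𝒯 𝒯.vert),
   chainRule r s copyChain (copyBase r),
   imp (atom copyChain) (compare r s 𝒯 Eq),
   imp (atom widthChain) (inter (allRole s (neg top))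
    (allRole r (union (atom widthChain) (nominal 1)))),
   imp (atom widthChain) (seesOnly r s (imp (atom cell₁) (only 𝒯 𝒯.init)))]

/-- The first element of a chain. -/
noncomputable def chainTop (A : ConceptName) (B : Concept) : Concept :=
  conj [atom A, somewhere r s B, seesOnly r s (imp (atom cell₀) (only 𝒯 𝒯.acc))]

/-- The part of the concept that does not depend on the input. -/
noncomputable def frame : Concept :=
  conj [existsRole r (chainTop r s 𝒯 rowChain (rowBase r s)),
    existsRole r (chainTop r s 𝒯 copyChain (copyBase r)), everywhere r s (conj (rules r s 𝒯))]

/-- The cells after the last symbol of the input. -/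
noncomputable def blanks : Concept :=
  allRole s (everywhere r s (imp (atom cell₀) (only 𝒯 𝒯.blank)))

/-- The input is written on the cells along the `s`-edges. -/
noncomputable def word : List Γ → Concept
  | [] => blanks r s 𝒯
  | a :: w => allRole s (inter (only 𝒯 (𝒯.letter a)) (word w))

/-- The concept that is satisfiable iff the tile system tiles some cylinder with input `w`. -/
noncomputable def tilingConcept (w : List Γ) : Concept :=
  inter (frame r s 𝒯) (everywhere r s (imp (nominal 0) (word r s 𝒯 w)))

variable {r s 𝒯}

theorem basic_allTiles {F : 𝒯.Tile → Concept} :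
    (allTiles 𝒯 F).Basic r s ↔ ∀ t, (F t).Basic r s := by
  simp [allTiles, basic_conj]

theorem basic_only {P : 𝒯.Tile → Prop} : (only 𝒯 P).Basic r s := by
  refine basic_allTiles.2 fun t => ?_
  split_ifs <;> trivial

theorem basic_word (w : List Γ) : (word r s 𝒯 w).Basic r s := by
  induction w with
  | nil => simp [word, blanks, Basic, basic_allRole, basic_everywhere, basic_imp, basic_only]
  | cons a w ih => simp [word, Basic, basic_allRole, basic_only, ih]

theorem basic_tilingConcept (w : List Γ) : (tilingConcept r s 𝒯 w).Basic r s := by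
  simp [tilingConcept, frame, chainTop, rules, sequenceRules, chainRule, rowBase, copyBase, compare,
    Basic, basic_allRole, basic_everywhere, basic_imp, basic_only, basic_word, basic_conj,
    basic_somewhere, basic_seesOnly, basic_seesSome, basic_union, basic_allTiles]

variable {I : Interpretation} {d : I.Domain}

theorem mem_ext_allTiles {F : 𝒯.Tile → Concept} :
    d ∈ I.ext (allTiles 𝒯 F) ↔ ∀ t, d ∈ I.ext (F t) := by
  simp [allTiles, mem_ext_conj]

theorem mem_ext_only {P : 𝒯.Tile → Prop} :
    d ∈ I.ext (only 𝒯 P) ↔ ∀ t, d ∈ I.concept (tileName 𝒯 t) → P t := by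
  refine mem_ext_allTiles.trans (forall_congr' fun t => ?_)
  split_ifs with h <;> simp [h, mem_ext_top, mem_ext_neg, mem_ext_atom]

/-- A concept cannot speak of two seen elements at once. Splitting over the finitely many tiles of
the first element leaves a universal condition on the second. -/
theorem mem_ext_compare {R : 𝒯.Tile → 𝒯.Tile → Prop} :
    d ∈ I.ext (compare r s 𝒯 R) ↔
      ∀ e, I.Sees r s d e → e ∈ I.concept cell₀ → ∀ t, e ∈ I.concept (tileName 𝒯 t) →
      ∀ e', I.Sees r s d e' → e' ∈ I.concept cell₁ → ∀ t', e' ∈ I.concept (tileName 𝒯 t') →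
      R t t' := by
  simp only [compare, mem_ext_allTiles, mem_ext_imp, mem_ext_seesSome, mem_ext_seesOnly,
    mem_ext_inter, mem_ext_atom, mem_ext_only]
  grind

end Tiling

/-! ### From models to tilings -/

theorem exists_sequence {α : Type} {R : α → α → Prop} {X : Set α} {o : α} (ho : o ∈ X)
    (h : ∀ z ∈ X, ∃ y ∈ X, R z y) : ∃ e : ℕ → α, e 0 = o ∧ ∀ i, e i ∈ X ∧ R (e i) (e (i + 1)) := by
  choose! g hg using h
  have hX (i : ℕ) : g^[i] o ∈ X := by
    induction i with
    | zero => exact ho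
    | succ i ih => rw [Function.iterate_succ_apply']; exact (hg _ ih).1
  refine ⟨fun i => g^[i] o, rfl, fun i => ⟨hX i, ?_⟩⟩
  have := (hg _ (hX i)).2
  rwa [← Function.iterate_succ_apply' g i o] at this

/-- If the elements of `X` outside `B` have only `R`-edges, which lead to elements of `X`, then a
path from `X` to `B` contains a chain of `R`-edges to its first element in `B`. -/
theorem exists_chain {α : Type} {R S : α → α → Prop} {X B : Set α} {x b : α}
    (hpath : Relation.ReflTransGen (fun y z => R y z ∨ S y z) x b) (hb : b ∈ B) (hx : x ∈ X)
    (h : ∀ z, Relation.ReflTransGen (fun y z => R y z ∨ S y z) x z → z ∈ X →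
      z ∈ B ∨ (∀ y, ¬ S z y) ∧ ∀ y, R z y → y ∈ X) :
    ∃ c n, c ∈ B ∧ Relation.ReflTransGen (fun y z => R y z ∨ S y z) x c ∧ StepsOf R n x c ∧
      ∀ p ≤ n, ∃ y ∈ X, Relation.ReflTransGen (fun y z => R y z ∨ S y z) x y ∧
        StepsOf R p y c ∧ (0 < p → y ∉ B) := by
  induction hpath using Relation.ReflTransGen.head_induction_on with
  | refl =>
    refine ⟨b, 0, hb, .refl, rfl, fun p hp => ⟨b, hx, .refl, ?_, by omega⟩⟩
    obtain rfl : p = 0 := by omega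
    rfl
  | @head x y hxy hpath ih =>
    by_cases hxB : x ∈ B
    · refine ⟨x, 0, hxB, .refl, rfl, fun p hp => ⟨x, hx, .refl, ?_, by omega⟩⟩
      obtain rfl : p = 0 := by omega
      rfl
    · obtain ⟨hS, hR⟩ := (h x .refl hx).resolve_left hxB
      have hr := hxy.resolve_right (hS y)
      obtain ⟨c, n, hc, hyc, hn, hp⟩ := ih (hR y hr) fun z hz => h z (.head hxy hz)
      refine ⟨c, n + 1, hc, .head hxy hyc, ⟨y, hr, hn⟩, fun p hpn => ?_⟩
      rcases Nat.lt_or_ge n p with hlt | hle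
      · obtain rfl : p = n + 1 := by omega
        exact ⟨x, hx, .refl, ⟨y, hr, hn⟩, fun _ => hxB⟩
      · obtain ⟨z, hzX, hyz, hz⟩ := hp p hle
        exact ⟨z, hzX, .head hxy hyz, hz⟩

theorem StepsOf.of_sequence {α : Type} {R : α → α → Prop} {e : ℕ → α}
    (h : ∀ i, R (e i) (e (i + 1))) (i : ℕ) : StepsOf R i (e 0) (e i) := by
  induction i with
  | zero => rfl
  | succ i ih => exact ih.snoc (h i)

theorem StepsOf.reflTransGen {α : Type} {R T : α → α → Prop} (hRT : ∀ y z, R y z → T y z) {n : ℕ}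
    {x y : α} (h : StepsOf R n x y) : Relation.ReflTransGen T x y := by
  induction n generalizing x with
  | zero => obtain rfl : x = y := h; exact .refl
  | succ n ih =>
    obtain ⟨z, h1, h2⟩ := h
    exact .head (hRT _ _ h1) (ih h2)

namespace Tiling

open ALCO.Concept ALCO.Interpretation

variable {Γ : Type} {r s : RoleName} {𝒯 : TileSystem Γ} {I : Interpretation}

theorem mem_ext_chainRule {A : ConceptName} {B : Concept} {d : I.Domain} :
    d ∈ I.ext (chainRule r s A B) ↔ (d ∈ I.concept A →
      d ∈ I.ext B ∨ (∀ e, ¬ I.role s d e) ∧ ∀ e, I.role r d e → e ∈ I.concept A) := by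
  simp [chainRule, mem_ext_imp, mem_ext_union, mem_ext_inter, mem_ext_allRole, mem_ext_atom,
    mem_ext_neg, mem_ext_top]

/-- Successors along `s` need not be unique; any choice works, as the rules constrain all of them.
The nominal itself is not required to be a cell, so tile `i` sits on element `i + 1`. -/
theorem exists_tile_sequence {a : IndName} {A : ConceptName} {x : I.Domain}
    (hx : I.Connected r s x (I.ind a))
    (h : ∀ d, I.Connected r s x d → ∀ C ∈ sequenceRules s 𝒯 a A, d ∈ I.ext C) :
    ∃ e : ℕ → I.Domain, e 0 = I.ind a ∧ ∀ i, I.Connected r s x (e i) ∧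
      I.role s (e i) (e (i + 1)) ∧ e (i + 1) ∈ I.concept A ∧
      ∃ t, e (i + 1) ∈ I.concept (tileName 𝒯 t) := by
  simp only [sequenceRules, List.forall_mem_cons, List.not_mem_nil, mem_ext_imp, mem_ext_nominal,
    mem_ext_existsRole, mem_ext_allRole, mem_ext_atom, mem_ext_top, mem_ext_neg, mem_ext_only,
    and_true, not_forall, false_imp_iff, implies_true, not_false_eq_true, exists_prop] at h
  have hnext (z y : I.Domain) (hz : I.Connected r s x z)
      (hz' : z = I.ind a ∨ z ∈ I.concept A) (hy : I.role s z y) : y ∈ I.concept A :=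
    hz'.elim (fun h' => (h z hz).2.1 h' y hy) fun h' => (h z hz).2.2.2.1 h' y hy
  obtain ⟨e, he, he'⟩ := exists_sequence (R := I.role s)
    (X := {z | I.Connected r s x z ∧ (z = I.ind a ∨ z ∈ I.concept A)}) ⟨hx, Or.inl rfl⟩ (by
      rintro z ⟨hz, hz'⟩
      obtain ⟨y, hy⟩ := hz'.elim (h z hz).1 (h z hz).2.2.1
      exact ⟨y, ⟨hz.tail (Or.inr hy), Or.inr (hnext z y hz hz' hy)⟩, hy⟩)
  refine ⟨e, he, fun i => ?_⟩
  have h1 := hnext _ _ (he' i).1.1 (he' i).1.2 (he' i).2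
  exact ⟨(he' i).1.1, (he' i).2, h1, (h _ (he' (i + 1)).1.1).2.2.2.2 h1⟩

theorem mem_word {w : List Γ} {e : ℕ → I.Domain} (he : ∀ i, I.role s (e i) (e (i + 1)))
    (hc : ∀ i, e (i + 1) ∈ I.concept cell₀) (h : e 0 ∈ I.ext (word r s 𝒯 w)) (t : 𝒯.Tile) (i : ℕ)
    (ht : e (i + 1) ∈ I.concept (tileName 𝒯 t)) :
    (∀ hi : i < w.length, 𝒯.letter w[i] t) ∧ (w.length ≤ i → 𝒯.blank t) := by
  induction w generalizing e i with
  | nil =>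
    refine ⟨fun hi => absurd hi (Nat.not_lt_zero i), fun _ => ?_⟩
    simp only [word, blanks, mem_ext_allRole, mem_ext_everywhere, mem_ext_imp, mem_ext_atom,
      mem_ext_only] at h
    refine h (e 1) (he 0) (e (i + 1)) ?_ (hc i) t ht
    have := StepsOf.of_sequence (e := fun j => e (j + 1)) (fun j => he (j + 1)) i
    exact this.reflTransGen fun _ _ => Or.inr
  | cons a w ih =>
    simp only [word, mem_ext_allRole, mem_ext_inter, mem_ext_only] at h
    obtain ⟨h1, h2⟩ := h (e 1) (he 0)
    cases i with
    | zero => exact ⟨fun _ => h1 t ht, fun h => absurd h (by simp)⟩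
    | succ i =>
      have := ih (e := fun j => e (j + 1)) (fun j => he (j + 1)) (fun j => hc (j + 1)) h2 i ht
      refine ⟨fun hi => ?_, fun hi => this.2 (by simpa using hi)⟩
      rw [List.getElem_cons_succ]
      exact this.1 (by simpa using hi)

/-- Names may coincide and elements may see more than intended, but all conditions used are
universal, so it is enough to exhibit the paths. -/
theorem exists_tiles {w : List Γ} (h : (tilingConcept r s 𝒯 w).Satisfiable) :
    ∃ W m f, 𝒯.Tiles w W m f := by
  obtain ⟨I, x, hframe, hword⟩ := h
  simp only [frame, mem_ext_conj, List.forall_mem_cons, mem_ext_existsRole, chainTop,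
    mem_ext_everywhere, mem_ext_atom, mem_ext_somewhere, mem_ext_seesOnly, mem_ext_imp,
    mem_ext_only, mem_ext_nominal, List.not_mem_nil, false_imp_iff, implies_true, and_true]
    at hframe hword
  obtain ⟨⟨d, hxd, hd, ⟨b, hdb, hb⟩, hdacc⟩, ⟨g, hxg, hg, ⟨c, hgc, hc⟩, hgacc⟩, hrules⟩ := hframe
  simp only [rules, List.mem_append, or_imp, forall_and, List.forall_mem_cons, List.not_mem_nil,
    false_imp_iff, implies_true, and_true] at hrules
  obtain ⟨⟨hseq₀, hseq₁⟩, hstart, hhoriz, hrow, hvert, hcopy, heq, hwidth, hinit⟩ := hrules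
  simp only [mem_ext_imp, mem_ext_nominal, mem_ext_allRole, mem_ext_atom, mem_ext_only,
    mem_ext_allTiles, mem_ext_compare, mem_ext_chainRule, mem_ext_inter, mem_ext_neg, mem_ext_top,
    mem_ext_union, mem_ext_seesOnly, not_true_eq_false, imp_false]
    at hstart hhoriz hrow hvert hcopy heq hwidth hinit
  have hxd' : I.Connected r s x d := .single (Or.inl hxd)
  have hxg' : I.Connected r s x g := .single (Or.inl hxg)
  -- The first base element on each path ends a pure `r`-chain; `M` and `N` are the lengths of the
  -- row chain and the copy chain.
  obtain ⟨b, M, hb, hdb, hM, hDchain⟩ := exists_chain (R := I.role r) (S := I.role s)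
    (X := I.concept rowChain) (B := I.ext (rowBase r s)) hdb hb hd
    fun z hz => hrow z (hxd'.trans hz)
  obtain ⟨c, N, hc, hgc, hN, hGchain⟩ := exists_chain (R := I.role r) (S := I.role s)
    (X := I.concept copyChain) (B := I.ext (copyBase r)) hgc hc hg
    fun z hz => hcopy z (hxg'.trans hz)
  simp only [rowBase, copyBase, mem_ext_inter, mem_ext_existsRole, mem_ext_conj,
    List.forall_mem_cons, mem_ext_nominal, mem_ext_atom, mem_ext_neg, mem_ext_somewhere,
    List.not_mem_nil, false_imp_iff, implies_true, and_true, exists_eq_right] at hb hc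
  obtain ⟨hb0, y, hby, hy, hy1, hy1'⟩ := hb
  have hxb : I.Connected r s x b := hxd'.trans hdb
  have hxy : I.Connected r s x y := hxb.tail (Or.inl hby)
  -- The last `r`-edge of the width chain leaves the label and enters nominal 1, which is therefore
  -- added to `X`.
  obtain ⟨_, W, rfl, -, hW, hFchain⟩ := exists_chain (R := I.role r) (S := I.role s)
    (X := {z | z ∈ I.concept widthChain ∨ z = I.ind 1}) (B := {I.ind 1}) hy1' rfl (Or.inl hy)
    (by
      rintro z hz (h | h)
      · exact Or.inr (hwidth z (hxy.trans hz) h)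
      · exact Or.inl h)
  -- `rowBase` excludes that the width chain starts at nominal 1.
  have hW0 : 0 < W := Nat.pos_of_ne_zero fun h => hy1 (by subst h; exact hW)
  obtain ⟨e, he0, he⟩ := exists_tile_sequence (hxb.tail (Or.inl hb0)) fun z hz => hseq₀ z hz
  obtain ⟨e', he0', he'⟩ := exists_tile_sequence (hxy.trans hy1') fun z hz => hseq₁ z hz
  choose hxe hs hcell f hf using he
  choose _ hs' hcell' f' hf' using he'
  have hsees (z : I.Domain) (p : ℕ) (h : StepsOf (I.role r) p z (I.ind 0)) : I.Sees r s z (e p) :=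
    ⟨p, _, h, he0 ▸ StepsOf.of_sequence hs p⟩
  have hsees' (z : I.Domain) (p : ℕ) (h : StepsOf (I.role r) p z (I.ind 1)) :
      I.Sees r s z (e' p) := ⟨p, _, h, he0' ▸ StepsOf.of_sequence hs' p⟩
  have hcopy (p : ℕ) (hp : p ≤ N) : f p = f' p := by
    obtain ⟨z, hz, hgz, hzc, -⟩ := hGchain p hp
    exact heq z (hxg'.trans hgz) hz _ (hsees z (p + 1) (hzc.snoc hc.1)) (hcell p) _ (hf p) _
      (hsees' z (p + 1) (hzc.snoc hc.2)) (hcell' p) _ (hf' p)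
  have hword' (i : ℕ) := mem_word hs hcell (he0 ▸ hword (I.ind 0) (he0 ▸ hxe 0) rfl) (f i) i (hf i)
  -- Vertical matching needs the row chain at `i` and the copy chain at `i + W`, so it is available
  -- up to `min M N`. The top of the shorter chain sees precisely this tile and makes it accepting.
  refine ⟨W, min M N, f, hW0, fun i => ?_, fun i hi => ?_, fun i hi him => ?_, ?_, ?_,
    fun i => (hword' i).1, fun i => (hword' i).2⟩
  · exact hhoriz _ (hxe (i + 1)) (hcell i) _ (hf i) _ (hs (i + 1)) _ (hf (i + 1))
  · obtain ⟨z, hz, hdz, hzb, -⟩ := hDchain i (by omega)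
    rw [hcopy (i + W) (by omega)]
    -- Beyond `b` there are one step to `y` and `W` steps along the width chain.
    have hzW : StepsOf (I.role r) (i + W + 1) z (I.ind 1) := hzb.trans (n := W + 1) ⟨y, hby, hW⟩
    exact hvert z (hxd'.trans hdz) hz _ (hsees z (i + 1) (hzb.snoc hb0)) (hcell i) _ (hf i) _
      (hsees' z _ hzW) (hcell' _) _ (hf' _)
  -- The element at distance `i + 1` from nominal 1 is not the nominal, so it is labelled as part of
  -- the width chain and sees tile `i` of the second sequence.
  · obtain ⟨z, hz, hyz, hzo, hzB⟩ := hFchain (i + 1) (by omega)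
    rw [hcopy i (by omega)]
    exact hinit z (hxy.trans hyz) (hz.resolve_right (hzB (by omega))) _ (hsees' z _ hzo)
      (hcell' i) _ (hf' i)
  · rcases le_total M N with h | h
    · rw [min_eq_left h]
      exact hdacc _ (hsees d (M + 1) (hM.snoc hb0)) (hcell M) _ (hf M)
    · rw [min_eq_right h]
      exact hgacc _ (hsees g (N + 1) (hN.snoc hc.1)) (hcell N) _ (hf N)
  · exact hstart (e 0) (hxe 0) he0 _ (hs 0) _ (hf 0)

end Tiling

/-! ### From tilings to models -/

theorem StepsOf.mono {α : Type} {R T : α → α → Prop} (hRT : ∀ y z, R y z → T y z) {n : ℕ}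
    {x y : α} (h : StepsOf R n x y) : StepsOf T n x y := by
  induction n generalizing x with
  | zero => exact h
  | succ n ih =>
    obtain ⟨z, h1, h2⟩ := h
    exact ⟨z, hRT _ _ h1, ih h2⟩

namespace Tiling

open ALCO.Concept ALCO.Interpretation

/-- The elements of the model: the root, the three chains and the two sequences of cells, each
preceded by its nominal. -/
inductive Node
  | root
  | row (p : ℕ)
  | copy (p : ℕ)
  | width (p : ℕ)
  | seq₀ (i : ℕ)
  | seq₁ (i : ℕ)

namespace Node

/-- The `r`-edges of the model for circumference `W`, whose chains have `m` edges. -/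
inductive REdge (W m : ℕ) : Node → Node → Prop
  | rootRow : REdge W m root (row m)
  | rootCopy : REdge W m root (copy m)
  | row (p : ℕ) : REdge W m (row (p + 1)) (row p)
  | copy (p : ℕ) : REdge W m (copy (p + 1)) (copy p)
  | width (p : ℕ) : REdge W m (width (p + 1)) (width p)
  | rowSeq₀ : REdge W m (row 0) (seq₀ 0)
  | rowWidth : REdge W m (row 0) (width (W - 1))
  | copySeq₀ : REdge W m (copy 0) (seq₀ 0)
  | copySeq₁ : REdge W m (copy 0) (seq₁ 0)
  | widthSeq₁ : REdge W m (width 0) (seq₁ 0)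

/-- The `s`-edges of the model. -/
inductive SEdge : Node → Node → Prop
  | seq₀ (i : ℕ) : SEdge (seq₀ i) (seq₀ (i + 1))
  | seq₁ (i : ℕ) : SEdge (seq₁ i) (seq₁ (i + 1))

variable {W m : ℕ}

theorem of_stepsOf_seq₀ {n k : ℕ} {y : Node} (h : StepsOf SEdge n y (seq₀ k)) :
    ∃ i, y = seq₀ i ∧ k = i + n := by
  induction n generalizing y with
  | zero => exact ⟨k, h, rfl⟩
  | succ n ih =>
    obtain ⟨z, hz, h⟩ := h
    obtain ⟨i, rfl, rfl⟩ := ih h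
    cases hz with
    | seq₀ i => exact ⟨i, rfl, by omega⟩

theorem of_stepsOf_seq₁ {n k : ℕ} {y : Node} (h : StepsOf SEdge n y (seq₁ k)) :
    ∃ i, y = seq₁ i ∧ k = i + n := by
  induction n generalizing y with
  | zero => exact ⟨k, h, rfl⟩
  | succ n ih =>
    obtain ⟨z, hz, h⟩ := h
    obtain ⟨i, rfl, rfl⟩ := ih h
    cases hz with
    | seq₁ i => exact ⟨i, rfl, by omega⟩

theorem eq_of_stepsOf_from_seq₀ {n i : ℕ} {y : Node}
    (h : StepsOf (REdge W m) n (seq₀ i) y) : n = 0 ∧ y = seq₀ i := by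
  cases n with
  | zero => exact ⟨rfl, Eq.symm h⟩
  | succ n => obtain ⟨z, hz, -⟩ := h; cases hz

theorem eq_of_stepsOf_from_seq₁ {n i : ℕ} {y : Node}
    (h : StepsOf (REdge W m) n (seq₁ i) y) : n = 0 ∧ y = seq₁ i := by
  cases n with
  | zero => exact ⟨rfl, Eq.symm h⟩
  | succ n => obtain ⟨z, hz, -⟩ := h; cases hz

theorem stepsOf_width_seq₀ {n p i : ℕ} (h : StepsOf (REdge W m) n (width p) (seq₀ i)) : False := by
  induction n generalizing p with
  | zero => cases h
  | succ n ih =>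
    obtain ⟨z, hz, h⟩ := h
    cases hz with
    | width p => exact ih h
    | widthSeq₁ => cases (eq_of_stepsOf_from_seq₁ h).2

theorem stepsOf_width_seq₁ {n p i : ℕ} (h : StepsOf (REdge W m) n (width p) (seq₁ i)) :
    i = 0 ∧ n = p + 1 := by
  induction n generalizing p with
  | zero => cases h
  | succ n ih =>
    obtain ⟨z, hz, h⟩ := h
    cases hz with
    | width p => obtain ⟨h1, h2⟩ := ih h; omega
    | widthSeq₁ => obtain ⟨rfl, h⟩ := eq_of_stepsOf_from_seq₁ h; cases h; simp

theorem stepsOf_copy_seq₀ {n p i : ℕ} (h : StepsOf (REdge W m) n (copy p) (seq₀ i)) :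
    i = 0 ∧ n = p + 1 := by
  induction n generalizing p with
  | zero => cases h
  | succ n ih =>
    obtain ⟨z, hz, h⟩ := h
    cases hz with
    | copy p => obtain ⟨h1, h2⟩ := ih h; omega
    | copySeq₀ => obtain ⟨rfl, h⟩ := eq_of_stepsOf_from_seq₀ h; cases h; simp
    | copySeq₁ => cases (eq_of_stepsOf_from_seq₁ h).2

theorem stepsOf_copy_seq₁ {n p i : ℕ} (h : StepsOf (REdge W m) n (copy p) (seq₁ i)) :
    i = 0 ∧ n = p + 1 := by
  induction n generalizing p with
  | zero => cases h
  | succ n ih =>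
    obtain ⟨z, hz, h⟩ := h
    cases hz with
    | copy p => obtain ⟨h1, h2⟩ := ih h; omega
    | copySeq₁ => obtain ⟨rfl, h⟩ := eq_of_stepsOf_from_seq₁ h; cases h; simp
    | copySeq₀ => cases (eq_of_stepsOf_from_seq₀ h).2

theorem stepsOf_row_seq₀ {n p i : ℕ} (h : StepsOf (REdge W m) n (row p) (seq₀ i)) :
    i = 0 ∧ n = p + 1 := by
  induction n generalizing p with
  | zero => cases h
  | succ n ih =>
    obtain ⟨z, hz, h⟩ := h
    cases hz with
    | row p => obtain ⟨h1, h2⟩ := ih h; omega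
    | rowSeq₀ => obtain ⟨rfl, h⟩ := eq_of_stepsOf_from_seq₀ h; cases h; simp
    | rowWidth => cases stepsOf_width_seq₀ h

/-- The length is `p` to `row 0`, 1 to `width (W - 1)`, `W - 1` to `width 0` and 1 to `seq₁ 0`; for
`W = 0` the truncated subtraction would spoil the count. -/
theorem stepsOf_row_seq₁ (hW : 0 < W) {n p i : ℕ}
    (h : StepsOf (REdge W m) n (row p) (seq₁ i)) : i = 0 ∧ n = p + W + 1 := by
  induction n generalizing p with
  | zero => cases h
  | succ n ih =>
    obtain ⟨z, hz, h⟩ := h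
    cases hz with
    | row p => obtain ⟨h1, h2⟩ := ih h; omega
    | rowSeq₀ => cases (eq_of_stepsOf_from_seq₀ h).2
    | rowWidth => obtain ⟨h1, h2⟩ := stepsOf_width_seq₁ h; omega

end Node

variable {Γ : Type} (r s : RoleName) (𝒯 : TileSystem Γ) (W m : ℕ) (f : ℕ → 𝒯.Tile)

/-- The elements that carry a concept name. -/
def label (A : ℕ) : Node → Prop
  | .root => False
  | .row _ => A = rowChain
  | .copy _ => A = copyChain
  | .width _ => A = widthChain
  | .seq₀ 0 => False
  | .seq₀ (i + 1) => A = cell₀ ∨ A = tileName 𝒯 (f i)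
  | .seq₁ 0 => False
  | .seq₁ (i + 1) => A = cell₁ ∨ A = tileName 𝒯 (f i)

/-- The model given by a sequence of tiles. -/
noncomputable def model : Interpretation where
  Domain := Node
  ind a := if a = 0 then .seq₀ 0 else .seq₁ 0
  concept A := {x | label 𝒯 f A x}
  role ρ x y := ρ = r ∧ Node.REdge W m x y ∨ ρ = s ∧ Node.SEdge x y

variable {r s 𝒯 W m f}

local notation "𝓜" => model r s 𝒯 W m f

theorem model_role_r (hrs : r ≠ s) {x y : (𝓜).Domain} :
    (𝓜).role r x y ↔ Node.REdge W m x y := by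
  simp [model, hrs]

theorem model_role_s (hrs : r ≠ s) {x y : (𝓜).Domain} :
    (𝓜).role s x y ↔ Node.SEdge x y := by
  simp [model, hrs.symm]

theorem model_sees (hrs : r ≠ s) {x y : Node} (h : (𝓜).Sees r s x y) :
    ∃ n z, StepsOf (Node.REdge W m) n x z ∧ StepsOf Node.SEdge n z y := by
  obtain ⟨n, z, h1, h2⟩ := h
  exact ⟨n, z, h1.mono fun _ _ => (model_role_r hrs).1, h2.mono fun _ _ => (model_role_s hrs).1⟩

theorem eq_of_mem_cell₀ {x : Node} (h : x ∈ (𝓜).concept cell₀) : ∃ i, x = .seq₀ (i + 1) := by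
  change label 𝒯 f cell₀ x at h
  rcases x with _ | _ | _ | _ | ⟨_ | i⟩ | ⟨_ | i⟩ <;>
    simp [label, cell₀, cell₁, rowChain, copyChain, widthChain] at h ⊢
  exact absurd (h ▸ five_le_tileName 𝒯 _) (by decide)

theorem eq_of_mem_cell₁ {x : Node} (h : x ∈ (𝓜).concept cell₁) : ∃ i, x = .seq₁ (i + 1) := by
  change label 𝒯 f cell₁ x at h
  rcases x with _ | _ | _ | _ | ⟨_ | i⟩ | ⟨_ | i⟩ <;>
    simp [label, cell₀, cell₁, rowChain, copyChain, widthChain] at h ⊢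
  exact absurd (h ▸ five_le_tileName 𝒯 _) (by decide)

theorem eq_of_mem_rowChain {x : Node} (h : x ∈ (𝓜).concept rowChain) : ∃ p, x = .row p := by
  change label 𝒯 f rowChain x at h
  rcases x with _ | _ | _ | _ | ⟨_ | i⟩ | ⟨_ | i⟩ <;>
    simp [label, cell₀, cell₁, rowChain, copyChain, widthChain] at h ⊢ <;>
    exact absurd (h ▸ five_le_tileName 𝒯 _) (by decide)

theorem eq_of_mem_copyChain {x : Node} (h : x ∈ (𝓜).concept copyChain) : ∃ p, x = .copy p := by
  change label 𝒯 f copyChain x at h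
  rcases x with _ | _ | _ | _ | ⟨_ | i⟩ | ⟨_ | i⟩ <;>
    simp [label, cell₀, cell₁, rowChain, copyChain, widthChain] at h ⊢ <;>
    exact absurd (h ▸ five_le_tileName 𝒯 _) (by decide)

theorem eq_of_mem_widthChain {x : Node} (h : x ∈ (𝓜).concept widthChain) : ∃ p, x = .width p := by
  change label 𝒯 f widthChain x at h
  rcases x with _ | _ | _ | _ | ⟨_ | i⟩ | ⟨_ | i⟩ <;>
    simp [label, cell₀, cell₁, rowChain, copyChain, widthChain] at h ⊢ <;>
    exact absurd (h ▸ five_le_tileName 𝒯 _) (by decide)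

theorem eq_tile_seq₀ {i : ℕ} {t : 𝒯.Tile}
    (h : Node.seq₀ (i + 1) ∈ (𝓜).concept (tileName 𝒯 t)) : t = f i := by
  have := five_le_tileName 𝒯 t
  rcases h with h | h
  · rw [h] at this; exact absurd this (by decide)
  · exact tileName_injective 𝒯 h

theorem eq_tile_seq₁ {i : ℕ} {t : 𝒯.Tile}
    (h : Node.seq₁ (i + 1) ∈ (𝓜).concept (tileName 𝒯 t)) : t = f i := by
  have := five_le_tileName 𝒯 t
  rcases h with h | h
  · rw [h] at this; exact absurd this (by decide)
  · exact tileName_injective 𝒯 h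

theorem sequenceRules_seq₀ (hrs : r ≠ s) (x : (𝓜).Domain) :
    ∀ C ∈ sequenceRules s 𝒯 0 cell₀, x ∈ (𝓜).ext C := by
  simp only [sequenceRules, List.forall_mem_cons, List.not_mem_nil, mem_ext_imp, mem_ext_nominal,
    mem_ext_existsRole, mem_ext_allRole, mem_ext_atom, mem_ext_top, mem_ext_neg, mem_ext_only,
    and_true, not_forall, false_imp_iff, implies_true, not_false_eq_true, exists_prop,
    model_role_s hrs]
  refine ⟨?_, ?_, fun h => ?_, fun h => ?_, fun h => ?_⟩
  · rintro rfl
    exact ⟨_, .seq₀ 0⟩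
  · rintro rfl _ ⟨⟩
    exact Or.inl rfl
  · obtain ⟨i, rfl⟩ := eq_of_mem_cell₀ h
    exact ⟨_, .seq₀ _⟩
  · obtain ⟨i, rfl⟩ := eq_of_mem_cell₀ h
    rintro _ ⟨⟩
    exact Or.inl rfl
  · obtain ⟨i, rfl⟩ := eq_of_mem_cell₀ h
    exact ⟨f i, Or.inr rfl⟩

theorem sequenceRules_seq₁ (hrs : r ≠ s) (x : (𝓜).Domain) :
    ∀ C ∈ sequenceRules s 𝒯 1 cell₁, x ∈ (𝓜).ext C := by
  simp only [sequenceRules, List.forall_mem_cons, List.not_mem_nil, mem_ext_imp, mem_ext_nominal,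
    mem_ext_existsRole, mem_ext_allRole, mem_ext_atom, mem_ext_top, mem_ext_neg, mem_ext_only,
    and_true, not_forall, false_imp_iff, implies_true, not_false_eq_true, exists_prop,
    model_role_s hrs]
  refine ⟨?_, ?_, fun h => ?_, fun h => ?_, fun h => ?_⟩
  · rintro rfl
    exact ⟨_, .seq₁ 0⟩
  · rintro rfl _ ⟨⟩
    exact Or.inl rfl
  · obtain ⟨i, rfl⟩ := eq_of_mem_cell₁ h
    exact ⟨_, .seq₁ _⟩
  · obtain ⟨i, rfl⟩ := eq_of_mem_cell₁ h
    rintro _ ⟨⟩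
    exact Or.inl rfl
  · obtain ⟨i, rfl⟩ := eq_of_mem_cell₁ h
    exact ⟨f i, Or.inr rfl⟩

/-- All `r`-paths from a chain element to the head of a given sequence have the same length, and no
`r`-edge enters a later cell. So exactly one cell of the sequence can be seen, here the one after `p
+ 1` steps, which carries `f p`. -/
theorem row_sees_seq₀ (hrs : r ≠ s) {p i : ℕ} (h : (𝓜).Sees r s (.row p) (.seq₀ (i + 1))) :
    i = p := by
  obtain ⟨n, z, h1, h2⟩ := model_sees hrs h
  obtain ⟨j, rfl, hj⟩ := Node.of_stepsOf_seq₀ h2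
  have := Node.stepsOf_row_seq₀ h1
  omega

theorem row_sees_seq₁ (hrs : r ≠ s) (hW : 0 < W) {p i : ℕ}
    (h : (𝓜).Sees r s (.row p) (.seq₁ (i + 1))) : i = p + W := by
  obtain ⟨n, z, h1, h2⟩ := model_sees hrs h
  obtain ⟨j, rfl, hj⟩ := Node.of_stepsOf_seq₁ h2
  have := Node.stepsOf_row_seq₁ hW h1
  omega

theorem copy_sees_seq₀ (hrs : r ≠ s) {p i : ℕ} (h : (𝓜).Sees r s (.copy p) (.seq₀ (i + 1))) :
    i = p := by
  obtain ⟨n, z, h1, h2⟩ := model_sees hrs h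
  obtain ⟨j, rfl, hj⟩ := Node.of_stepsOf_seq₀ h2
  have := Node.stepsOf_copy_seq₀ h1
  omega

theorem copy_sees_seq₁ (hrs : r ≠ s) {p i : ℕ} (h : (𝓜).Sees r s (.copy p) (.seq₁ (i + 1))) :
    i = p := by
  obtain ⟨n, z, h1, h2⟩ := model_sees hrs h
  obtain ⟨j, rfl, hj⟩ := Node.of_stepsOf_seq₁ h2
  have := Node.stepsOf_copy_seq₁ h1
  omega

theorem width_sees_seq₁ (hrs : r ≠ s) {p i : ℕ} (h : (𝓜).Sees r s (.width p) (.seq₁ (i + 1))) :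
    i = p := by
  obtain ⟨n, z, h1, h2⟩ := model_sees hrs h
  obtain ⟨j, rfl, hj⟩ := Node.of_stepsOf_seq₁ h2
  have := Node.stepsOf_width_seq₁ h1
  omega

theorem connected_descending {a : ℕ → Node} (hrs : r ≠ s)
    (h : ∀ p, Node.REdge W m (a (p + 1)) (a p)) (p : ℕ) : (𝓜).Connected r s (a p) (a 0) := by
  induction p with
  | zero => exact .refl
  | succ p ih => exact .head (Or.inl ((model_role_r hrs).2 (h p))) ih

theorem row_mem_rowBase (hrs : r ≠ s) : (Node.row 0 : Node) ∈ (𝓜).ext (rowBase r s) := by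
  refine mem_ext_inter.2 ⟨mem_ext_existsRole.2 ⟨.seq₀ 0, (model_role_r hrs).2 .rowSeq₀, rfl⟩,
    mem_ext_existsRole.2 ⟨.width (W - 1), (model_role_r hrs).2 .rowWidth, ?_⟩⟩
  refine ⟨rfl, Node.noConfusion, mem_ext_somewhere.2 ⟨Node.seq₁ 0, ?_, rfl⟩, trivial⟩
  exact (connected_descending hrs .width _).tail (Or.inl ((model_role_r hrs).2 .widthSeq₁))

theorem copy_mem_copyBase (hrs : r ≠ s) : (Node.copy 0 : Node) ∈ (𝓜).ext (copyBase r) :=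
  mem_ext_inter.2 ⟨mem_ext_existsRole.2 ⟨.seq₀ 0, (model_role_r hrs).2 .copySeq₀, rfl⟩,
    mem_ext_existsRole.2 ⟨.seq₁ 0, (model_role_r hrs).2 .copySeq₁, rfl⟩⟩

/-- The width chain is as long as the circumference, so only its first `W` elements are used. -/
def InUse (W : ℕ) : Node → Prop
  | .width p => p < W
  | _ => True

theorem inUse_of_connected (hrs : r ≠ s) (hW : 0 < W) {x y : Node} (hx : InUse W x)
    (h : (𝓜).Connected r s x y) : InUse W y := by
  induction h with
  | refl => exact hx
  | tail _ h ih =>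
    rcases h with h | h
    · cases (model_role_r hrs).1 h with
      | rowWidth => exact Nat.sub_lt hW one_pos
      | width p => exact (Nat.lt_succ_self p).trans ih
      | _ => trivial
    · cases (model_role_s hrs).1 h <;> trivial

/-- As the tiling never ends, the rules for the row and copy chains hold at every index, reachable
or not. Only the initial condition on the width chain uses `hx`. -/
theorem mem_ext_rules (hrs : r ≠ s) {w : List Γ} (hf : 𝒯.TilesForever w W m f) {x : (𝓜).Domain}
    (hx : InUse W x) : ∀ C ∈ rules r s 𝒯, x ∈ (𝓜).ext C := by
  simp only [rules, List.mem_append, or_imp, forall_and, List.forall_mem_cons, List.not_mem_nil,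
    false_imp_iff, implies_true, and_true]
  refine ⟨⟨sequenceRules_seq₀ hrs x, sequenceRules_seq₁ hrs x⟩, ?_⟩
  simp only [mem_ext_imp, mem_ext_nominal, mem_ext_allRole, mem_ext_atom, mem_ext_only,
    mem_ext_allTiles, mem_ext_compare, mem_ext_chainRule, mem_ext_inter, mem_ext_neg, mem_ext_top,
    mem_ext_union, mem_ext_seesOnly, not_true_eq_false, imp_false, model_role_r hrs,
    model_role_s hrs]
  refine ⟨?_, fun h t ht => ?_, fun h => ?_, fun h => ?_, fun h => ?_, fun h => ?_, fun h => ?_,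
    fun h => ?_⟩
  · rintro rfl _ ⟨⟩ t ht
    rw [eq_tile_seq₀ ht]
    exact hf.start
  · obtain ⟨i, rfl⟩ := eq_of_mem_cell₀ h
    rintro _ ⟨⟩ t' ht'
    rw [eq_tile_seq₀ ht, eq_tile_seq₀ ht']
    exact hf.horiz i
  · obtain ⟨p, rfl⟩ := eq_of_mem_rowChain h
    cases p with
    | zero => exact Or.inl (row_mem_rowBase hrs)
    | succ p =>
      refine Or.inr ⟨by rintro _ ⟨⟩, ?_⟩
      rintro _ ⟨⟩
      rfl
  · obtain ⟨p, rfl⟩ := eq_of_mem_rowChain h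
    intro y hy hyc t ht y' hy' hyc' t' ht'
    obtain ⟨i, rfl⟩ := eq_of_mem_cell₀ hyc
    obtain ⟨i', rfl⟩ := eq_of_mem_cell₁ hyc'
    rw [eq_tile_seq₀ ht, eq_tile_seq₁ ht', row_sees_seq₀ hrs hy, row_sees_seq₁ hrs hf.pos hy']
    exact hf.vert p
  · obtain ⟨p, rfl⟩ := eq_of_mem_copyChain h
    cases p with
    | zero => exact Or.inl (copy_mem_copyBase hrs)
    | succ p =>
      refine Or.inr ⟨by rintro _ ⟨⟩, ?_⟩
      rintro _ ⟨⟩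
      rfl
  · obtain ⟨p, rfl⟩ := eq_of_mem_copyChain h
    intro y hy hyc t ht y' hy' hyc' t' ht'
    obtain ⟨i, rfl⟩ := eq_of_mem_cell₀ hyc
    obtain ⟨i', rfl⟩ := eq_of_mem_cell₁ hyc'
    rw [eq_tile_seq₀ ht, eq_tile_seq₁ ht', copy_sees_seq₀ hrs hy, copy_sees_seq₁ hrs hy']
  · obtain ⟨p, rfl⟩ := eq_of_mem_widthChain h
    refine ⟨by rintro _ ⟨⟩, ?_⟩
    rintro _ ⟨⟩
    · exact Or.inl rfl
    · exact Or.inr rfl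
  · obtain ⟨p, rfl⟩ := eq_of_mem_widthChain h
    intro y hy hyc t ht
    obtain ⟨i, rfl⟩ := eq_of_mem_cell₁ hyc
    rw [eq_tile_seq₁ ht, width_sees_seq₁ hrs hy]
    exact hf.init p hx

theorem connected_seq₀ (hrs : r ≠ s) {i : ℕ} {x : Node} (h : (𝓜).Connected r s (.seq₀ i) x) :
    ∃ j, i ≤ j ∧ x = .seq₀ j := by
  induction h with
  | refl => exact ⟨i, le_rfl, rfl⟩
  | tail _ h ih =>
    obtain ⟨j, hj, rfl⟩ := ih
    rcases h with h | h
    · cases (model_role_r hrs).1 h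
    · cases (model_role_s hrs).1 h
      exact ⟨j + 1, by omega, rfl⟩

/-- The offset `k` is needed for the induction: the successor of `seq₀ k` carries `f k`, and the
rest of the input starts there. -/
theorem mem_ext_word (hrs : r ≠ s) {w : List Γ} {k : ℕ}
    (hw : ∀ i (hi : i < w.length), 𝒯.letter w[i] (f (k + i)))
    (hb : ∀ i, k + w.length ≤ i → 𝒯.blank (f i)) {x : (𝓜).Domain} (hx : x = Node.seq₀ k) :
    x ∈ (𝓜).ext (word r s 𝒯 w) := by
  induction w generalizing k x with
  | nil =>
    simp only [word, blanks, mem_ext_allRole, mem_ext_everywhere, mem_ext_imp, mem_ext_atom,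
      mem_ext_only, model_role_s hrs]
    subst hx
    rintro _ ⟨⟩ x hx - t ht
    obtain ⟨j, hj, rfl⟩ := connected_seq₀ hrs hx
    obtain ⟨j, rfl⟩ : ∃ i, j = i + 1 := ⟨j - 1, by omega⟩
    rw [eq_tile_seq₀ ht]
    exact hb j (by simpa using hj)
  | cons a w ih =>
    simp only [word, mem_ext_allRole, mem_ext_inter, mem_ext_only, model_role_s hrs]
    subst hx
    rintro _ ⟨⟩
    refine ⟨fun t ht => ?_, ih (fun i hi => ?_) (fun i hi => hb i ?_) rfl⟩
    · rw [eq_tile_seq₀ ht]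
      exact hw 0 (by simp)
    · have := hw (i + 1) (by simpa using hi)
      rwa [List.getElem_cons_succ, show k + (i + 1) = k + 1 + i by ring] at this
    · rw [List.length_cons]; omega

theorem satisfiable_tilingConcept (hrs : r ≠ s) {w : List Γ} (hf : 𝒯.TilesForever w W m f) :
    (tilingConcept r s 𝒯 w).Satisfiable := by
  suffices h : ∀ x : (𝓜).Domain, x = Node.root → x ∈ (𝓜).ext (tilingConcept r s 𝒯 w) from
    ⟨𝓜, _, h _ rfl⟩
  intro x hx
  refine mem_ext_inter.2 ⟨?_, ?_⟩
  · simp only [frame, mem_ext_conj, List.forall_mem_cons, mem_ext_existsRole, chainTop,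
      mem_ext_everywhere, mem_ext_atom, mem_ext_somewhere, mem_ext_seesOnly, mem_ext_imp,
      mem_ext_only, List.not_mem_nil, false_imp_iff, implies_true, and_true]
    subst hx
    refine ⟨⟨Node.row m, (model_role_r hrs).2 .rootRow, rfl,
      ⟨Node.row 0, connected_descending hrs .row m, row_mem_rowBase hrs⟩, fun x hx hxc t ht => ?_⟩,
      ⟨Node.copy m, (model_role_r hrs).2 .rootCopy, rfl,
      ⟨Node.copy 0, connected_descending hrs .copy m, copy_mem_copyBase hrs⟩, fun x hx hxc t ht => ?_⟩,
      fun x hx => mem_ext_rules hrs hf (inUse_of_connected hrs hf.pos (x := Node.root) trivial hx)⟩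
    · obtain ⟨i, rfl⟩ := eq_of_mem_cell₀ hxc
      rw [eq_tile_seq₀ ht, row_sees_seq₀ hrs hx]
      exact hf.acc m le_rfl
    · obtain ⟨i, rfl⟩ := eq_of_mem_cell₀ hxc
      rw [eq_tile_seq₀ ht, copy_sees_seq₀ hrs hx]
      exact hf.acc m le_rfl
  · rw [mem_ext_everywhere]
    intro y _
    rw [mem_ext_imp]
    rintro rfl
    exact mem_ext_word hrs (fun i hi => by rw [zero_add]; exact hf.letter i hi)
      (fun i hi => hf.blank i (by omega)) rfl

end Tiling

end ALCO

/-! ### Computability of the reduction and undecidability -/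

namespace ALCO.Tiling

open ALCO.Concept

/-- The concept is a right fold over the input, and the letter conditions form a finite table
because the alphabet is finite. -/
theorem primrec_code_word {Γ : Type} [Primcodable Γ] [Finite Γ] (r s : RoleName)
    (𝒯 : TileSystem Γ) : Primrec fun w : List Γ => (word r s 𝒯 w).code := by
  let step : Γ × ℕ → ℕ := fun p => Nat.pair 2 (Nat.pair 5 (Nat.pair s (Nat.pair 2
    (Nat.pair 3 (Nat.pair (only 𝒯 (𝒯.letter p.1)).code p.2)))))
  have hstep : Primrec step := by
    have hpair {g : Γ × ℕ → ℕ} (k : ℕ) (hg : Primrec g) : Primrec fun p => Nat.pair k (g p) :=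
      Primrec₂.natPair.comp (Primrec.const k) hg
    exact hpair 2 (hpair 5 (hpair s (hpair 2 (hpair 3 (Primrec₂.natPair.comp
      ((Primrec.dom_finite fun a => (only 𝒯 (𝒯.letter a)).code).comp Primrec.fst) Primrec.snd)))))
  have hfold : Primrec fun w : List Γ => w.foldr (fun a n => step (a, n)) (blanks r s 𝒯).code :=
    Primrec.list_foldr (h := fun _ => step) .id (.const _) (hstep.comp₂ Primrec₂.right)
  refine hfold.of_eq fun w => ?_
  induction w with
  | nil => simp only [word, List.foldr_nil]
  | cons a w ih => simp only [List.foldr_cons, ih, step, word, allRole, code]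

theorem primrec_code_tilingConcept {Γ : Type} [Primcodable Γ] [Finite Γ] (r s : RoleName)
    (𝒯 : TileSystem Γ) : Primrec fun w : List Γ => (tilingConcept r s 𝒯 w).code := by
  have hpair {g : List Γ → ℕ} (k : ℕ) (hg : Primrec g) : Primrec fun w => Nat.pair k (g w) :=
    Primrec₂.natPair.comp (Primrec.const k) hg
  -- The input occurs only in the innermost component; the surrounding pairs consist of constructor
  -- tags and constant codes.
  exact hpair 3 (hpair _ (hpair 2 (hpair 6 (hpair _ (hpair 2 (hpair 2 (hpair 3 (hpair _ (hpair 2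
    (primrec_code_word r s 𝒯))))))))))

/-- Satisfiability is undecidable for every class that contains all basic concepts. -/
theorem not_satDecidableOn {r s : RoleName} (hrs : r ≠ s) {P : Concept → Prop}
    (hP : ∀ C : Concept, C.Basic r s → P C) : ¬ SatDecidableOn P := by
  rintro ⟨f, hf, hfP⟩
  obtain ⟨Γ, Λ, _, _, _, _, M, S, w, hS, hw, hM⟩ := exists_universal_tm0
  let C (c : Nat.Partrec.Code) : Concept :=
    tilingConcept r s (Turing.TM0.tileSystem M S) (w (Encodable.encode c))
  have hC (c : Nat.Partrec.Code) : (C c).Satisfiable ↔ (c.eval 0).Dom := by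
    rw [← hM]
    constructor
    · intro h
      obtain ⟨W, m, g, hg⟩ := exists_tiles h
      exact Turing.TM0.eval_dom_of_tiles hg
    · intro h
      obtain ⟨W, m, g, hg⟩ := Turing.TM0.exists_tilesForever hS h
      exact satisfiable_tilingConcept hrs hg
  have hcode : Computable fun c => (C c).code :=
    ((primrec_code_tilingConcept r s _).comp (hw.comp Primrec.encode)).to_comp
  classical
  -- The function `f` may diverge elsewhere, but on the codes of the concepts `C c` it halts with
  -- the correct answer, so its composition with the reduction is a total decision procedure for
  -- halting.
  refine ComputablePred.halting_problem 0 ⟨inferInstance, (hf.comp hcode).of_eq fun c => ?_⟩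
  obtain ⟨h1, h2⟩ := hfP (C c) (hP _ (basic_tilingConcept _))
  rw [hC] at h1 h2
  by_cases h : (c.eval 0).Dom
  · simpa [h] using Part.eq_some_iff.2 (h1 h)
  · simpa [h] using Part.eq_some_iff.2 (h2 h)

end ALCO.Tiling

theorem mainTheorem1 (κ : ALCO.RoleName → ALCO.LetterKind) (r s : ALCO.RoleName)
    (hr : κ r = ALCO.LetterKind.call) (hs : κ s = ALCO.LetterKind.ret) :
    ¬ ALCO.Concept.SatDecidableOn (fun C => C.IsVPL κ) ∧
    ¬ ALCO.Concept.SatDecidableOn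
        (fun C => C.IsVPL κ ∧ C.UsesOnly (ALCO.nineLanguages r s)) := by
  have hrs : r ≠ s := by
    rintro rfl
    rw [hr] at hs
    cases hs
  exact ⟨ALCO.Tiling.not_satDecidableOn hrs fun C hC => hC.isVPL hr hs,
    ALCO.Tiling.not_satDecidableOn hrs fun C hC => ⟨hC.isVPL hr hs, hC.usesOnly⟩⟩
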